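/- The augmented cube $AQ_n$ ($n\ge 1$) is the graph on the binary strings of length $n$ defined recursively: $AQ_1=K_2$, and for $n\ge 2$ the graph $AQ_n$ consists of two disjoint copies of $AQ_{n-1}$, whose vertices are prefixed by $0$ and by $1$ respectively, together with the edges joining each vertex $0x_1x_2\dots x_{n-1}$ to both $1x_1x_2\dots x_{n-1}$ and $1\overline{x_1}\,\overline{x_2}\dots\overline{x_{n-1}}$, where $\overline{x_i}=1-x_i$. For a connected simple graph $G$ and a set $D\subseteq V(G)$ with $|D|\ge 2$, a $D$-path is a path in $G$ containing all vertices of $D$; $D$-paths $P_1,\dots,P_m$ are internally disjoint if $V(P_i)\cap V(P_j)=D$ and $E(P_i)\cap E(P_j)=\emptyset$ for all $i\ne j$. Let $\pi_G(D)$ be the maximum number of internally disjoint $D$-paths in $G$, and for $2\le k\le |V(G)|$ let $\pi_k(G)=\min\{\pi_G(D) : D\subseteq V(G),\ |D|=k\}$ be the $k$-path-connectivity of $G$. **Theorem.** For every even integer $n\ge 4$, $\pi_3(AQ_n)=\frac{3n}{2}-2$. -/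

import Mathlib

/-- The augmented cube `AQ n` on the bit strings of length `n` (`x 0` is the leading bit).
`AQ 0` is a single vertex.  `AQ (n + 1)` consists of two copies of `AQ n`, on the strings with
leading bit `0` and with leading bit `1`; in addition every string of the first copy is joined to
the string of the second copy with the same remaining bits (hypercubic edge) and to the string of
the second copy with complemented remaining bits (complementary edge).
In particular `AQ 1` is the complete graph on two vertices. -/
def augmentedCube : (n : ℕ) → SimpleGraph (Fin n → Bool)
  | 0 => ⊥
  | n + 1 =>
    { Adj := fun x y =>
        (x 0 = y 0 ∧ (augmentedCube n).Adj (Fin.tail x) (Fin.tail y)) ∨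
        (x 0 ≠ y 0 ∧ (Fin.tail y = Fin.tail x ∨ Fin.tail y = fun i => !(Fin.tail x i)))
      symm := ⟨by
        rintro x y (⟨h, h'⟩ | ⟨h, h' | h'⟩)
        · exact Or.inl ⟨h.symm, h'.symm⟩
        · exact Or.inr ⟨h.symm, Or.inl h'.symm⟩
        · exact Or.inr ⟨h.symm, Or.inr (by rw [h']; simp)⟩⟩
      loopless := ⟨by
        rintro x (⟨-, h⟩ | ⟨h, -⟩)
        · exact (augmentedCube n).loopless.irrefl _ h
        · exact h rfl⟩ }

/-- `G` contains `m` internally disjoint `D`-paths: there are paths `P i`, for `i : Fin m`, each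
of which passes through all vertices of `D`, such that any two different ones have exactly the
vertices of `D` in common and share no edge. -/
def HasInternallyDisjointPaths {V : Type*} (G : SimpleGraph V) (D : Finset V) (m : ℕ) : Prop :=
  ∃ (a b : Fin m → V) (P : (i : Fin m) → G.Walk (a i) (b i)),
    (∀ i, (P i).IsPath ∧ ∀ v ∈ D, v ∈ (P i).support) ∧
    ∀ i j, i ≠ j →
      {v | v ∈ (P i).support ∧ v ∈ (P j).support} = (D : Set V) ∧
      (P i).edges.Disjoint (P j).edges

/-- `π_G(D)`, the maximum number of internally disjoint `D`-paths in `G`, as an element of `ℕ∞`. -/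
noncomputable def pathNumber {V : Type*} (G : SimpleGraph V) (D : Finset V) : ℕ∞ :=
  ⨆ (m : ℕ) (_ : HasInternallyDisjointPaths G D m), (m : ℕ∞)

/-- The `k`-path-connectivity `π_k(G)`: the minimum of `π_G(D)` over all sets `D` of `k`
vertices of `G`. -/
noncomputable def pathConnectivity {V : Type*} (G : SimpleGraph V) (k : ℕ) : ℕ∞ :=
  ⨅ (D : Finset V) (_ : D.card = k), pathNumber G D

/-! In Gray-code coordinates (each bit added to the preceding one) complementing a suffix flips one
coordinate and flipping a single non-final bit flips two consecutive ones. So the augmented cube is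
the Cayley graph of `(ZMod 2)^n` for the 2n - 1 generators e_j and e_j + e_{j+1}. Write n = 2s + 4;
the claimed value is 3s + 4.

Upper bound: a path through three vertices uses at least four edge-ends at them. The vertices e_0,
e_2, e_0 + e_1 have the two common neighbours 0 and e_0 + e_1 + e_2; at each of these some edge to
the triple stays unused, since the neighbour lies on at most one path, which has at most two edges
there. Hence 4k + 2 ≤ 3(2n - 1), so k ≤ 3s + 4.

Lower bound: some coordinate i separates z from x and y. In each of the two layers keep a set S of
4s + 4 = 2n - 4 generators, including all unit vectors other than e_i. A set of vertices not
dominating its layer has at least |S| further vertices in its closed neighbourhood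
(`card_add_le_card_cubeNbhd`). By a Hall-type form of Menger's theorem
(`SimpleGraph.exists_disjoint_paths`) this gives 4s + 4 paths from the neighbours of y to x in their
layer, and fans of that size to z in the other layer. Cutting 2s of the former leaves 2s + 4
connections between x and y. The cut ends, together with two edges from each of x and y across the
layers, give 2s + 2 connections to z from each of x and y. Joining the connections in pairs yields s
+ 2 paths of each of the types z-x-y and x-y-z and s of type x-z-y. -/

open SimpleGraph

/-! ### Connectors and their assembly into internally disjoint paths -/

namespace SimpleGraph

/-- `G` contains a path from `u` to `v` whose inner vertices lie in `X`, and which consists of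
the edge `uv` only if `X` is empty. -/
def IsConnector {V : Type*} (G : SimpleGraph V) (u v : V) (X : Set V) : Prop :=
  ∃ p : G.Walk u v, p.IsPath ∧ (∀ t ∈ p.support, t = u ∨ t = v ∨ t ∈ X) ∧
    (s(u, v) ∈ p.edges → X = ∅)

variable {V : Type*} {G : SimpleGraph V}

theorem IsConnector.symm {u v : V} {X : Set V} (h : G.IsConnector u v X) :
    G.IsConnector v u X := by
  obtain ⟨p, hp, hs, he⟩ := h
  refine ⟨p.reverse, hp.reverse, fun t ht => ?_, fun h => he ?_⟩
  · have := hs t (by simpa using ht)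
    tauto
  · rw [Sym2.eq_swap]
    simpa using h

/-- The edge `uv` can occur only as the first edge; then `t = v`, so `q` is a closed path, hence
trivial, and the interior is empty. -/
theorem isConnector_cons {u t v : V} (h : G.Adj u t) (q : G.Walk t v) (hq : q.IsPath)
    (hu : u ∉ q.support) : G.IsConnector u v {w | w ∈ q.support ∧ w ≠ v} := by
  refine ⟨Walk.cons h q, hq.cons hu, fun w hw => ?_, fun he => ?_⟩
  · rw [Walk.support_cons, List.mem_cons] at hw
    by_cases hv : w = v
    · exact Or.inr (Or.inl hv)
    · exact hw.imp id fun hw => Or.inr ⟨hw, hv⟩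
  · rw [Walk.edges_cons, List.mem_cons] at he
    rcases he with he | he
    · obtain rfl : t = v := by
        rcases Sym2.eq_iff.1 he with ⟨-, h⟩ | ⟨h, h'⟩
        · exact h.symm
        · exact (h'.trans h).symm
      rw [(Walk.isPath_iff_nil.1 hq).eq_nil]
      ext w
      simp
    · exact absurd (q.fst_mem_support_of_mem_edges he) hu

theorem Walk.IsPath.append_of_inter {u v w : V} {p : G.Walk u v} {q : G.Walk v w}
    (hp : p.IsPath) (hq : q.IsPath) (h : ∀ t ∈ p.support, t ∈ q.support → t = v) :
    (p.append q).IsPath := by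
  rw [Walk.isPath_def] at hp hq ⊢
  rw [Walk.support_append]
  rw [← Walk.cons_tail_support q, List.nodup_cons] at hq
  refine hp.append hq.2 fun t ht ht' => hq.1 ?_
  obtain rfl := h t ht (List.mem_of_mem_tail ht')
  exact ht'

theorem IsConnector.join {u v w : V} {X Y : Set V} (hX : G.IsConnector u v X)
    (hY : G.IsConnector v w Y) (huv : u ≠ v) (huw : u ≠ w) (hvw : v ≠ w) (hXY : Disjoint X Y)
    (hXD : ∀ t ∈ X, t ≠ u ∧ t ≠ v ∧ t ≠ w) (hYD : ∀ t ∈ Y, t ≠ u ∧ t ≠ v ∧ t ≠ w) :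
    ∃ (a b : V) (P : G.Walk a b), P.IsPath ∧ (u ∈ P.support ∧ v ∈ P.support ∧ w ∈ P.support) ∧
      (∀ t ∈ P.support, t = u ∨ t = v ∨ t = w ∨ t ∈ X ∨ t ∈ Y) ∧
      (s(u, v) ∈ P.edges → X = ∅) ∧ (s(v, w) ∈ P.edges → Y = ∅) ∧ s(u, w) ∉ P.edges := by
  obtain ⟨p, hp, hps, hpe⟩ := hX
  obtain ⟨q, hq, hqs, hqe⟩ := hY
  have huq : u ∉ q.support := fun h => by
    rcases hqs u h with h | h | h
    · exact huv h
    · exact huw h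
    · exact (hYD u h).1 rfl
  have hwp : w ∉ p.support := fun h => by
    rcases hps w h with h | h | h
    · exact huw h.symm
    · exact hvw h.symm
    · exact (hXD w h).2.2 rfl
  refine ⟨u, w, p.append q, hp.append_of_inter hq ?_, ⟨by simp, by simp, by simp⟩, ?_, ?_, ?_, ?_⟩
  · intro t ht ht'
    rcases hps t ht with rfl | rfl | h
    · exact absurd ht' huq
    · rfl
    · rcases hqs t ht' with rfl | rfl | h'
      · rfl
      · exact absurd ht hwp
      · exact absurd h' (Set.disjoint_left.1 hXY h)
  · intro t ht
    rw [Walk.mem_support_append_iff] at ht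
    rcases ht with ht | ht
    · have := hps t ht
      tauto
    · have := hqs t ht
      tauto
  · intro h
    rw [Walk.edges_append, List.mem_append] at h
    exact h.elim hpe fun h => absurd (q.fst_mem_support_of_mem_edges h) huq
  · intro h
    rw [Walk.edges_append, List.mem_append] at h
    exact h.elim (fun h => absurd (p.snd_mem_support_of_mem_edges h) hwp) hqe
  · intro h
    rw [Walk.edges_append, List.mem_append] at h
    exact h.elim (fun h => hwp (p.snd_mem_support_of_mem_edges h))
      fun h => huq (q.fst_mem_support_of_mem_edges h)

end SimpleGraph

/-- Paths through `D` that are composed of connectors with disjoint interiors `X c`, no connector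
being used twice, are internally disjoint. -/
theorem hasInternallyDisjointPaths_of_connectors {V κ ι : Type*} [Fintype ι] {G : SimpleGraph V}
    {D : Finset V} {m : ℕ} (hm : Fintype.card ι = m) (X : κ → Set V) (ends : κ → Sym2 V)
    (hX : ∀ c c', c ≠ c' → Disjoint (X c) (X c'))
    (hends : ∀ c c', c ≠ c' → ends c = ends c' → X c = ∅ → X c' ≠ ∅)
    (U : ι → Set κ) (hU : ∀ k l, k ≠ l → Disjoint (U k) (U l))
    (hP : ∀ k, ∃ (a b : V) (P : G.Walk a b), P.IsPath ∧ (∀ v ∈ D, v ∈ P.support) ∧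
      (∀ t ∈ P.support, t ∈ D ∨ ∃ c ∈ U k, t ∈ X c) ∧
      ∀ e ∈ P.edges, (∀ v ∈ e, v ∈ D) → ∃ c ∈ U k, ends c = e ∧ X c = ∅) :
    HasInternallyDisjointPaths G D m := by
  choose a b P hpath hD hsupp hedge using hP
  let f : Fin m ≃ ι := (Fintype.equivFinOfCardEq hm).symm
  refine ⟨fun i => a (f i), fun i => b (f i), fun i => P (f i),
    fun i => ⟨hpath _, hD _⟩, fun i j hij => ?_⟩
  have hUU := hU (f i) (f j) (f.injective.ne hij)
  have hcommon : ∀ v, v ∈ (P (f i)).support → v ∈ (P (f j)).support → v ∈ D := by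
    intro v hi hj
    rcases hsupp _ v hi with h | ⟨c, hc, hv⟩
    · exact h
    rcases hsupp _ v hj with h | ⟨c', hc', hv'⟩
    · exact h
    -- A common vertex outside `D` would lie in the interiors of two different connectors.
    have hne : c ≠ c' := fun h => Set.disjoint_left.1 hUU hc (h ▸ hc')
    exact absurd hv' (Set.disjoint_left.1 (hX c c' hne) hv)
  refine ⟨?_, ?_⟩
  · ext v
    exact ⟨fun h => hcommon v h.1 h.2, fun h => ⟨hD _ v h, hD _ v h⟩⟩
  · intro e hi hj
    -- Both ends of a shared edge are shared vertices, so it is an edge inside `D`; it then comes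
    -- from two different connectors with the same ends and empty interiors, which `hends` forbids.
    have heD : ∀ v ∈ e, v ∈ D := fun v hv =>
      hcommon v (Walk.mem_support_of_mem_edges hi hv) (Walk.mem_support_of_mem_edges hj hv)
    obtain ⟨c, hc, hce, hcX⟩ := hedge _ e hi heD
    obtain ⟨c', hc', hce', hcX'⟩ := hedge _ e hj heD
    have hne : c ≠ c' := fun h => Set.disjoint_left.1 hUU hc (h ▸ hc')
    exact hends c c' hne (hce.trans hce'.symm) hcX hcX'

theorem SimpleGraph.IsConnector.exists_path_through {V κ : Type*} [DecidableEq V]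
    {G : SimpleGraph V} {u v w : V} {D : Finset V}
    (hD : D = {u, v, w}) (huv : u ≠ v) (huw : u ≠ w) (hvw : v ≠ w)
    (X : κ → Set V) (ends : κ → Sym2 V) (hXD : ∀ c, ∀ t ∈ X c, t ∉ D) {c c' : κ}
    (hX : Disjoint (X c) (X c')) (hc : ends c = s(u, v)) (hc' : ends c' = s(v, w))
    (h : G.IsConnector u v (X c)) (h' : G.IsConnector v w (X c')) :
    ∃ (a b : V) (P : G.Walk a b), P.IsPath ∧ (∀ v ∈ D, v ∈ P.support) ∧
      (∀ t ∈ P.support, t ∈ D ∨ ∃ d ∈ ({c, c'} : Set κ), t ∈ X d) ∧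
      ∀ e ∈ P.edges, (∀ v ∈ e, v ∈ D) → ∃ d ∈ ({c, c'} : Set κ), ends d = e ∧ X d = ∅ := by
  have hne : ∀ c, ∀ t ∈ X c, t ≠ u ∧ t ≠ v ∧ t ≠ w := fun c t ht => by
    have := hXD c t ht
    simpa [hD] using this
  obtain ⟨a, b, P, hP, hsub, hs, h1, h2, h3⟩ := h.join h' huv huw hvw hX (hne c) (hne c')
  refine ⟨a, b, P, hP, ?_, ?_, ?_⟩
  · intro t ht
    simp only [hD, Finset.mem_insert, Finset.mem_singleton] at ht
    rcases ht with rfl | rfl | rfl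
    exacts [hsub.1, hsub.2.1, hsub.2.2]
  · intro t ht
    simp only [hD, Finset.mem_insert, Finset.mem_singleton, Set.mem_insert_iff,
      Set.mem_singleton_iff, exists_eq_or_imp, exists_eq_left]
    have := hs t ht
    tauto
  · intro e he heD
    induction e using Sym2.ind with
    | _ p q =>
    have hpq : p ≠ q := (P.adj_of_mem_edges he).ne
    have hp := heD p (by simp)
    have hq := heD q (by simp)
    simp only [hD, Finset.mem_insert, Finset.mem_singleton] at hp hq
    simp only [Set.mem_insert_iff, Set.mem_singleton_iff, exists_eq_or_imp, exists_eq_left, hc, hc']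
    rcases hp with rfl | rfl | rfl <;> rcases hq with rfl | rfl | rfl
    · exact absurd rfl hpq
    · exact Or.inl ⟨rfl, h1 he⟩
    · exact absurd he h3
    · exact Or.inl ⟨Sym2.eq_swap, h1 (Sym2.eq_swap ▸ he)⟩
    · exact absurd rfl hpq
    · exact Or.inr ⟨rfl, h2 he⟩
    · exact absurd (Sym2.eq_swap ▸ he) h3
    · exact Or.inr ⟨Sym2.eq_swap, h2 (Sym2.eq_swap ▸ he)⟩
    · exact absurd rfl hpq

/-- `2r` connectors between `x` and `y` and `r + s` connectors from `z` to each of `x` and `y`,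
all with disjoint interiors, combine to `2r + s` internally disjoint paths through `x, y, z`. -/
theorem hasInternallyDisjointPaths_of_three_families {V I J K : Type*} [Fintype I] [Fintype J]
    [Fintype K] [DecidableEq V] {G : SimpleGraph V} {x y z : V} (hxy : x ≠ y) (hxz : x ≠ z)
    (hyz : y ≠ z) {r s : ℕ} (hI : Fintype.card I = r + r) (hJ : Fintype.card J = r + s)
    (hK : Fintype.card K = r + s) (X : I ⊕ J ⊕ K → Set V)
    (hX : ∀ c c', c ≠ c' → Disjoint (X c) (X c'))
    (hXD : ∀ c, ∀ t ∈ X c, t ≠ x ∧ t ≠ y ∧ t ≠ z)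
    (cI : ∀ i, G.IsConnector x y (X (.inl i))) (cJ : ∀ j, G.IsConnector x z (X (.inr (.inl j))))
    (cK : ∀ k, G.IsConnector y z (X (.inr (.inr k))))
    (eI : ∀ i i', i ≠ i' → X (.inl i) = ∅ → X (.inl i') ≠ ∅)
    (eJ : ∀ i i', i ≠ i' → X (.inr (.inl i)) = ∅ → X (.inr (.inl i')) ≠ ∅)
    (eK : ∀ i i', i ≠ i' → X (.inr (.inr i)) = ∅ → X (.inr (.inr i')) ≠ ∅) :
    HasInternallyDisjointPaths G {x, y, z} (r + (r + s)) := by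
  have fI : Fin r ⊕ Fin r ≃ I := Fintype.equivOfCardEq (by simp [hI])
  have fJ : Fin r ⊕ Fin s ≃ J := Fintype.equivOfCardEq (by simp [hJ])
  have fK : Fin r ⊕ Fin s ≃ K := Fintype.equivOfCardEq (by simp [hK])
  let ends : I ⊕ J ⊕ K → Sym2 V :=
    Sum.elim (fun _ => s(x, y)) (Sum.elim (fun _ => s(x, z)) fun _ => s(y, z))
  -- The three summands are the paths z-x-y, x-y-z and x-z-y. They consume 2r connectors of `I` and
  -- r + s of each of `J` and `K`, that is, all of them.
  let U : Fin r ⊕ Fin r ⊕ Fin s → Set (I ⊕ J ⊕ K) :=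
    Sum.elim (fun i => {.inr (.inl (fJ (.inl i))), .inl (fI (.inl i))})
      (Sum.elim (fun i => {.inl (fI (.inr i)), .inr (.inr (fK (.inl i)))})
        fun i => {.inr (.inl (fJ (.inr i))), .inr (.inr (fK (.inr i)))})
  have hXD' : ∀ c, ∀ t ∈ X c, t ∉ ({x, y, z} : Finset V) := fun c t ht => by
    have := hXD c t ht
    simpa using this
  have h12 : s(x, y) ≠ s(x, z) := by simp [hyz, hxz]
  have h13 : s(x, y) ≠ s(y, z) := by simp [hxy, hxz]
  have h23 : s(x, z) ≠ s(y, z) := by simp [hxy, hxz]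
  refine hasInternallyDisjointPaths_of_connectors (ι := Fin r ⊕ Fin r ⊕ Fin s) (by simp) X ends hX
    ?_ U ?_ ?_
  · rintro (i | i | i) (j | j | j) hij he <;> simp only [ends, Sum.elim_inl, Sum.elim_inr] at he
    · exact eI i j (by simpa using hij)
    · exact absurd he h12
    · exact absurd he h13
    · exact absurd he.symm h12
    · exact eJ i j (by simpa using hij)
    · exact absurd he h23
    · exact absurd he.symm h13
    · exact absurd he.symm h23
    · exact eK i j (by simpa using hij)
  · clear * -
    rintro (i | i | i) (j | j | j) hij <;>
      simp only [ne_eq, Sum.inl.injEq, Sum.inr.injEq, reduceCtorEq, not_false_eq_true] at hij <;>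
      simp [U, hij, Set.disjoint_left]
  · rintro (i | i | i)
    · refine IsConnector.exists_path_through (u := z) (v := x) (w := y) ?_ hxz.symm hyz.symm hxy X
        ends hXD' (hX _ _ (by simp)) Sym2.eq_swap rfl (cJ _).symm (cI _)
      ext t
      simp only [Finset.mem_insert, Finset.mem_singleton]
      tauto
    · exact IsConnector.exists_path_through rfl hxy hxz hyz X
        ends hXD' (hX _ _ (by simp)) rfl rfl (cI _) (cK _)
    · refine IsConnector.exists_path_through (u := x) (v := z) (w := y) ?_ hxz hxy hyz.symm X
        ends hXD' (hX _ _ (by simp)) rfl Sym2.eq_swap (cJ _) (cK _).symm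
      ext t
      simp only [Finset.mem_insert, Finset.mem_singleton]
      tauto

/-! ### Disjoint paths from Hall's marriage theorem -/

/-- A form of Menger's theorem: under a Hall-type condition on closed neighbourhoods inside `U`,
there are pairwise disjoint paths inside `U` from all vertices of `A` to vertices of `B`. -/
theorem SimpleGraph.exists_disjoint_paths {V : Type*} [Fintype V] [DecidableEq V]
    (G : SimpleGraph V) [DecidableRel G.Adj] (U A B : Finset V) (hAU : A ⊆ U)
    (hall : ∀ X ⊆ U \ B, X.card ≤ (U.filter fun v => v ∉ A ∧ ∃ u ∈ X, v = u ∨ G.Adj u v).card) :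
    ∃ (e : V → V) (P : ∀ a, G.Walk a (e a)), ∀ a ∈ A, (P a).IsPath ∧ e a ∈ B ∧
      (∀ v ∈ (P a).support, v ∈ U) ∧
      ∀ a' ∈ A, a ≠ a' → ∀ v ∈ (P a).support, v ∉ (P a').support := by
  classical
  let t : {v // v ∈ U \ B} → Finset V := fun u => U.filter fun v => v ∉ A ∧ (v = u ∨ G.Adj u v)
  obtain ⟨f, hf, hft⟩ := (Finset.all_card_le_biUnion_card_iff_exists_injective t).1 fun s => by
    have h := hall (s.map ⟨Subtype.val, Subtype.val_injective⟩) fun v hv => by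
      simp only [Finset.mem_map, Function.Embedding.coeFn_mk] at hv
      obtain ⟨u, -, rfl⟩ := hv
      exact u.2
    rw [Finset.card_map] at h
    refine h.trans (Finset.card_le_card fun v hv => ?_)
    simp only [Finset.mem_filter, Finset.mem_map, Function.Embedding.coeFn_mk] at hv
    obtain ⟨hvU, hvA, _, ⟨u, hu, rfl⟩, huv⟩ := hv
    exact Finset.mem_biUnion.2 ⟨u, hu, Finset.mem_filter.2 ⟨hvU, hvA, huv⟩⟩
  -- The matching is read as a successor map: on `U \ B` it is injective, avoids `A` and moves along
  -- edges or stays put. The desired paths follow its orbits from `A` until they meet `B`.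
  let F : V → V := fun v => if h : v ∈ U \ B then f ⟨v, h⟩ else v
  have hF : ∀ v ∈ U \ B, F v ∈ U ∧ F v ∉ A ∧ (F v = v ∨ G.Adj v (F v)) := fun v hv => by
    have := Finset.mem_filter.1 (hft ⟨v, hv⟩)
    simpa only [F, dif_pos hv] using this
  have hFinj : ∀ u ∈ U \ B, ∀ v ∈ U \ B, F u = F v → u = v := fun u hu v hv h => by
    simp only [F, dif_pos hu, dif_pos hv] at h
    exact congrArg Subtype.val (hf h)
  -- By injectivity two meeting orbits can be traced back in parallel until one reaches its start;
  -- as no successor lies in `A`, the other reaches its start at the same moment.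
  have cancel : ∀ k l a a', a ∈ A → a' ∈ A → (∀ j < k, F^[j] a ∈ U \ B) →
      (∀ j < l, F^[j] a' ∈ U \ B) → F^[k] a = F^[l] a' → k = l ∧ a = a' := by
    intro k
    induction k with
    | zero =>
      rintro (_ | l) a a' ha - - hl h
      · exact ⟨rfl, h⟩
      · rw [Function.iterate_succ_apply'] at h
        have := (hF _ (hl l (by omega))).2.1
        rw [← h] at this
        exact absurd ha this
    | succ k ih =>
      rintro (_ | l) a a' ha ha' hk hl h
      · rw [Function.iterate_succ_apply'] at h
        have := (hF _ (hk k (by omega))).2.1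
        rw [h] at this
        exact absurd ha' this
      · rw [Function.iterate_succ_apply', Function.iterate_succ_apply'] at h
        have := ih l a a' ha ha' (fun j hj => hk j (by omega)) (fun j hj => hl j (by omega))
          (hFinj _ (hk k (by omega)) _ (hl l (by omega)) h)
        exact ⟨by omega, this.2⟩
  have memU : ∀ a ∈ A, ∀ k, (∀ j < k, F^[j] a ∉ B) → F^[k] a ∈ U := by
    intro a ha k
    induction k with
    | zero => exact fun _ => hAU ha
    | succ k ih =>
      intro h
      rw [Function.iterate_succ_apply']
      exact (hF _ (Finset.mem_sdiff.2 ⟨ih fun j hj => h j (by omega), h k (by omega)⟩)).1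
  have walk : ∀ a k, (∀ j < k, F^[j] a ∈ U \ B) →
      ∃ p : G.Walk a (F^[k] a), ∀ v ∈ p.support, ∃ j ≤ k, v = F^[j] a := by
    intro a k
    induction k with
    | zero => exact fun _ => ⟨Walk.nil, fun v hv => ⟨0, le_rfl, by simpa using hv⟩⟩
    | succ k ih =>
      intro h
      obtain ⟨p, hp⟩ := ih fun j hj => h j (by omega)
      have hp' : ∀ v ∈ p.support, ∃ j ≤ k + 1, v = F^[j] a := fun v hv => by
        obtain ⟨j, hj, rfl⟩ := hp v hv
        exact ⟨j, by omega, rfl⟩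
      rw [Function.iterate_succ_apply']
      rcases (hF _ (h k (by omega))).2.2 with h' | h'
      · rw [h']
        exact ⟨p, hp'⟩
      · refine ⟨p.concat h', fun v hv => ?_⟩
        rw [Walk.support_concat, List.mem_append, List.mem_singleton] at hv
        rcases hv with hv | rfl
        · exact hp' v hv
        · exact ⟨k + 1, le_rfl, (Function.iterate_succ_apply' F k a).symm⟩
  have hex : ∀ a ∈ A, ∃ k, F^[k] a ∈ B := by
    intro a ha
    by_contra! h
    have hU : ∀ k, F^[k] a ∈ U \ B := fun k =>
      Finset.mem_sdiff.2 ⟨memU a ha k fun j _ => h j, h k⟩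
    -- An orbit that never meets `B` would repeat a vertex, contrary to `cancel`.
    obtain ⟨k, l, hkl, he⟩ := Finite.exists_ne_map_eq_of_infinite fun k => F^[k] a
    exact hkl (cancel k l a a ha ha (fun j _ => hU j) (fun j _ => hU j) he).1
  have key : ∀ a, ∃ (e : V) (P : G.Walk a e), a ∈ A → P.IsPath ∧ e ∈ B ∧
      (∀ v ∈ P.support, v ∈ U) ∧ ∀ v ∈ P.support, ∃ k, v = F^[k] a ∧ ∀ j < k, F^[j] a ∈ U \ B := by
    intro a
    by_cases ha : a ∈ A
    swap
    · exact ⟨a, Walk.nil, fun h => absurd h ha⟩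
    have hlt : ∀ j < Nat.find (hex a ha), F^[j] a ∉ B := fun j hj => Nat.find_min (hex a ha) hj
    have hUB : ∀ j < Nat.find (hex a ha), F^[j] a ∈ U \ B := fun j hj =>
      Finset.mem_sdiff.2 ⟨memU a ha j fun i hi => hlt i (hi.trans hj), hlt j hj⟩
    obtain ⟨p, hp⟩ := walk a _ hUB
    refine ⟨_, p.bypass, fun _ => ⟨p.bypass_isPath, Nat.find_spec (hex a ha), fun v hv => ?_,
      fun v hv => ?_⟩⟩
    · obtain ⟨j, hj, rfl⟩ := hp v (p.support_bypass_subset_support hv)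
      exact memU a ha j fun i hi => hlt i (hi.trans_le hj)
    · obtain ⟨j, hj, rfl⟩ := hp v (p.support_bypass_subset_support hv)
      exact ⟨j, rfl, fun i hi => hUB i (hi.trans_le hj)⟩
  choose e P hP using key
  refine ⟨e, P, fun a ha => ⟨(hP a ha).1, (hP a ha).2.1, (hP a ha).2.2.1, ?_⟩⟩
  intro a' ha' hne v hv hv'
  obtain ⟨k, rfl, hk⟩ := (hP a ha).2.2.2 v hv
  obtain ⟨l, hl, hl'⟩ := (hP a' ha').2.2.2 _ hv'
  exact hne (cancel k l a a' ha ha' hk hl' hl).2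

/-! ### Vertex expansion in cubes -/

theorem ZMod.two_eq_add_one_of_ne {a b : ZMod 2} (h : a ≠ b) : a = b + 1 := by
  revert a b
  decide

section Cube

variable {ι : Type*}

theorem add_self_zmod_two (v : ι → ZMod 2) : v + v = 0 := by
  funext k
  exact CharTwo.add_self_eq_zero _

theorem add_add_self_zmod_two (u v : ι → ZMod 2) : u + (u + v) = v := by
  rw [← add_assoc, add_self_zmod_two, zero_add]

theorem add_self_add_zmod_two (u v : ι → ZMod 2) : u + v + v = u := by
  rw [add_assoc, add_self_zmod_two, add_zero]

theorem add_eq_zero_iff_zmod_two {u v : ι → ZMod 2} : u + v = 0 ↔ u = v := by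
  refine ⟨fun h => ?_, fun h => h ▸ add_self_zmod_two u⟩
  rw [← add_self_add_zmod_two u v, h, zero_add]

/-- The Cayley graph of `(ZMod 2)^ι` with connection set `S`. -/
def cubeCayley (S : Finset (ι → ZMod 2)) : SimpleGraph (ι → ZMod 2) where
  Adj u v := u ≠ v ∧ u + v ∈ S
  symm := ⟨fun u v h => ⟨h.1.symm, add_comm u v ▸ h.2⟩⟩
  loopless := ⟨fun _ h => h.1 rfl⟩

variable [DecidableEq ι]

theorem card_le_of_eqOn_compl [Fintype ι] (I : Finset ι) (b : ι → ZMod 2)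
    (X : Finset (ι → ZMod 2)) (hX : ∀ v ∈ X, ∀ k ∉ I, v k = b k) : X.card ≤ 2 ^ I.card := by
  have h : X.card ≤ (Finset.univ : Finset (I → ZMod 2)).card := by
    refine Finset.card_le_card_of_injOn (fun v i => v i) (fun _ _ => Finset.mem_coe.2
      (Finset.mem_univ _)) fun u hu v hv huv => ?_
    funext k
    by_cases hk : k ∈ I
    · exact congrFun huv ⟨k, hk⟩
    · rw [hX u hu k hk, hX v hv k hk]
  simpa [ZMod.card] using h

/-- Translation by `d` moves `X` into the face containing `Y`, where it is disjoint from `Y`. -/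
theorem card_add_card_le_of_eqOn_compl [Fintype ι] (I : Finset ι) (b b' d : ι → ZMod 2)
    (hb : b' = b + d) (X Y : Finset (ι → ZMod 2)) (hX : ∀ v ∈ X, ∀ k ∉ I, v k = b k)
    (hY : ∀ v ∈ Y, ∀ k ∉ I, v k = b' k) (h : ∀ v ∈ X, v + d ∉ Y) :
    X.card + Y.card ≤ 2 ^ I.card := by
  have hd : Disjoint (X.image (· + d)) Y := by
    rw [Finset.disjoint_left]
    intro v hv
    obtain ⟨u, hu, rfl⟩ := Finset.mem_image.1 hv
    exact h u hu
  rw [← Finset.card_image_of_injective X (add_left_injective d), ← Finset.card_union_of_disjoint hd]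
  refine card_le_of_eqOn_compl I b' _ fun v hv k hk => ?_
  rcases Finset.mem_union.1 hv with hv | hv
  · obtain ⟨u, hu, rfl⟩ := Finset.mem_image.1 hv
    simp [hb, hX u hu k hk]
  · exact hY v hv k hk

/-- Two sets of vertices of a cube of dimension `m` without edges between them: if both are
non-empty, there are at least `m` further vertices, and `2m - 2` if both have two elements. -/
theorem cube_separation [Fintype ι] (I : Finset ι) : ∀ (b : ι → ZMod 2)
    (X Y : Finset (ι → ZMod 2)), (∀ v ∈ X, ∀ k ∉ I, v k = b k) → (∀ v ∈ Y, ∀ k ∉ I, v k = b k) →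
    Disjoint X Y → (∀ v ∈ X, ∀ j ∈ I, v + Pi.single j 1 ∉ Y) →
    (1 ≤ X.card → 1 ≤ Y.card → X.card + Y.card + I.card ≤ 2 ^ I.card) ∧
    (2 ≤ X.card → 2 ≤ Y.card → X.card + Y.card + 2 * I.card ≤ 2 ^ I.card + 2) := by
  induction I using Finset.induction_on with
  | empty =>
    intro b X Y hX hY hd _
    have := card_add_card_le_of_eqOn_compl ∅ b b 0 (by simp) X Y hX hY
      (by simpa using fun v hv => Finset.disjoint_left.1 hd hv)
    simp only [Finset.card_empty, pow_zero] at this ⊢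
    omega
  | insert j I hj ih =>
    intro b X Y hX hY hd hE
    have low : ∀ Z : Finset (ι → ZMod 2), (∀ v ∈ Z, ∀ k ∉ insert j I, v k = b k) →
        ∀ v ∈ Z.filter (fun v => v j = b j), ∀ k ∉ I, v k = b k := by
      intro Z hZ v hv k hk
      rw [Finset.mem_filter] at hv
      by_cases hkj : k = j
      · rw [hkj, hv.2]
      · exact hZ v hv.1 k (by simp [hkj, hk])
    have high : ∀ Z : Finset (ι → ZMod 2), (∀ v ∈ Z, ∀ k ∉ insert j I, v k = b k) →
        ∀ v ∈ Z.filter (fun v => ¬ v j = b j), ∀ k ∉ I, v k = (b + Pi.single j 1 : ι → ZMod 2) k := by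
      intro Z hZ v hv k hk
      rw [Finset.mem_filter] at hv
      by_cases hkj : k = j
      · subst hkj
        simpa using ZMod.two_eq_add_one_of_ne hv.2
      · simpa [hkj] using hZ v hv.1 k (by simp [hkj, hk])
    have hX0 := low X hX
    have hX1 := high X hX
    have hY0 := low Y hY
    have hY1 := high Y hY
    have cX := Finset.card_filter_add_card_filter_not (s := X) (fun v => v j = b j)
    have cY := Finset.card_filter_add_card_filter_not (s := Y) (fun v => v j = b j)
    have sub0 := fun (Z : Finset (ι → ZMod 2)) => Finset.filter_subset (fun v => v j = b j) Z
    have sub1 := fun (Z : Finset (ι → ZMod 2)) => Finset.filter_subset (fun v => ¬ v j = b j) Z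
    have edge : ∀ v ∈ X, ∀ k ∈ insert j I, v + Pi.single k 1 ∉ Y := hE
    obtain ⟨a0, b0⟩ := ih b _ _ hX0 hY0 (Finset.disjoint_of_subset_left (sub0 X)
      (Finset.disjoint_of_subset_right (sub0 Y) hd))
      fun v hv k hk h => hE v (sub0 X hv) k (Finset.mem_insert_of_mem hk) (sub0 Y h)
    obtain ⟨a1, b1⟩ := ih _ _ _ hX1 hY1 (Finset.disjoint_of_subset_left (sub1 X)
      (Finset.disjoint_of_subset_right (sub1 Y) hd))
      fun v hv k hk h => hE v (sub1 X hv) k (Finset.mem_insert_of_mem hk) (sub1 Y h)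
    -- Coordinate `j` halves the cube. The induction hypothesis handles each half; the edges in
    -- direction `j` bound the part of `X` in one half against the part of `Y` in the other. The
    -- rest is arithmetic with these inequalities.
    have c01 := card_add_card_le_of_eqOn_compl I b _ (Pi.single j 1) rfl _ _ hX0 hY1
      fun v hv h => hE v (sub0 X hv) j (Finset.mem_insert_self _ _) (sub1 Y h)
    have c10 := card_add_card_le_of_eqOn_compl I _ b (Pi.single j 1)
      (add_self_add_zmod_two _ _).symm _ _ hX1 hY0
      fun v hv h => hE v (sub1 X hv) j (Finset.mem_insert_self _ _) (sub0 Y h)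
    have c0 := card_le_of_eqOn_compl I b _ hX0
    have c1 := card_le_of_eqOn_compl I _ _ hX1
    have d0 := card_le_of_eqOn_compl I b _ hY0
    have d1 := card_le_of_eqOn_compl I _ _ hY1
    -- The linear bound 2m + 1 ≤ 2^m fails for m = 1 and m = 2, so the small dimensions are kept as
    -- exact values.
    have hpow : (I.card = 0 ∧ 2 ^ I.card = 1) ∨ (I.card = 1 ∧ 2 ^ I.card = 2) ∨
        (I.card = 2 ∧ 2 ^ I.card = 4) ∨
        (3 ≤ I.card ∧ 2 * I.card + 1 ≤ 2 ^ I.card) := by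
      clear * -
      generalize I.card = m
      have large : ∀ m, 2 * (m + 3) + 1 ≤ 2 ^ (m + 3) := by
        intro m
        induction m with
        | zero => norm_num
        | succ m ih =>
          rw [show m + 1 + 3 = (m + 3) + 1 by omega, pow_succ]
          omega
      rcases m with _ | _ | _ | m
      · simp
      · simp
      · simp
      · exact Or.inr (Or.inr (Or.inr ⟨by omega, large m⟩))
    rw [Finset.card_insert_of_notMem hj, pow_succ]
    rw [← cX, ← cY]
    generalize (X.filter fun v => v j = b j).card = x0 at *
    generalize (X.filter fun v => ¬ v j = b j).card = x1 at *
    generalize (Y.filter fun v => v j = b j).card = y0 at *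
    generalize (Y.filter fun v => ¬ v j = b j).card = y1 at *
    generalize 2 ^ I.card = p at *
    generalize I.card = m at *
    clear * - a0 b0 a1 b1 c01 c10 c0 c1 d0 d1 hpow
    have split : ∀ x y : ℕ, (1 ≤ x → 1 ≤ y → x + y + m ≤ p) →
        (2 ≤ x → 2 ≤ y → x + y + 2 * m ≤ p + 2) → x = 0 ∨ y = 0 ∨ (x = 1 ∧ 1 ≤ y ∧ 1 + y + m ≤ p) ∨
        (y = 1 ∧ 1 ≤ x ∧ x + 1 + m ≤ p) ∨
          (2 ≤ x ∧ 2 ≤ y ∧ x + y + m ≤ p ∧ x + y + 2 * m ≤ p + 2) := by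
      intro x y h1 h2
      by_cases hx : x = 0
      · exact Or.inl hx
      by_cases hy : y = 0
      · exact Or.inr (Or.inl hy)
      have h1 := h1 (by omega) (by omega)
      by_cases hx1 : x = 1
      · omega
      by_cases hy1 : y = 1
      · omega
      have h2 := h2 (by omega) (by omega)
      omega
    replace a0 := split _ _ a0 b0
    replace a1 := split _ _ a1 b1
    clear b0 b1 split
    constructor
    · intro h1 h2
      rcases a0 with a0 | a0 | a0 | a0 | a0 <;> rcases a1 with a1 | a1 | a1 | a1 | a1 <;> omega
    · intro h1 h2
      rcases a0 with a0 | a0 | a0 | a0 | a0 <;> rcases a1 with a1 | a1 | a1 | a1 | a1 <;> omega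

instance [Fintype ι] (S : Finset (ι → ZMod 2)) : DecidableRel (cubeCayley S).Adj := fun u v =>
  inferInstanceAs (Decidable (u ≠ v ∧ u + v ∈ S))

/-- The closed neighbourhood of a set in the Cayley graph with connection set `S`. -/
def cubeNbhd [Fintype ι] (S X : Finset (ι → ZMod 2)) : Finset (ι → ZMod 2) :=
  Finset.univ.filter fun v => ∃ u ∈ X, v = u ∨ (cubeCayley S).Adj u v

/-- A vertex set of the layer `v i = β` which does not dominate the layer expands well. -/
theorem card_add_le_card_cubeNbhd [Fintype ι] (i : ι) (β : ZMod 2) (S : Finset (ι → ZMod 2))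
    (hS : ∀ h ∈ S, h i = 0) (hS0 : 0 ∉ S) (hbasis : ∀ j ≠ i, Pi.single j 1 ∈ S) {K : ℕ}
    (hK : K ≤ S.card) (hK' : K + 4 ≤ 2 * Fintype.card ι) (X : Finset (ι → ZMod 2))
    (hX : ∀ v ∈ X, v i = β) (hne : X.Nonempty) (y : ι → ZMod 2) (hy : y i = β)
    (hyX : y ∉ cubeNbhd S X) : X.card + K ≤ (cubeNbhd S X).card := by
  set N := cubeNbhd S X with hN
  let L : Finset (ι → ZMod 2) := Finset.univ.filter fun v => v i = β
  have hXN : X ⊆ N := fun v hv => Finset.mem_filter.2 ⟨Finset.mem_univ _, v, hv, Or.inl rfl⟩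
  have hadd : ∀ v ∈ X, ∀ h ∈ S, v + h ∈ N := fun v hv h hh =>
    Finset.mem_filter.2 ⟨Finset.mem_univ _, v, hv, Or.inr ⟨fun he => hS0 (by
      rwa [left_eq_add.1 he] at hh), by rwa [add_add_self_zmod_two]⟩⟩
  have hNL : ∀ v ∈ N, v i = β := by
    intro v hv
    obtain ⟨u, hu, rfl | h⟩ := (Finset.mem_filter.1 hv).2
    · exact hX _ hu
    · have h0 : u i + v i = 0 := hS _ h.2
      rw [hX u hu] at h0
      rw [← CharTwo.add_eq_zero.1 h0]
  -- `Y` is the part of the layer not dominated by `X`, so no edge joins `X` to `Y`. If `X` is a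
  -- single vertex, its `S.card` neighbours suffice; if `Y` is one, its neighbours all lie in `N`
  -- outside `X`; otherwise `cube_separation` applies.
  let Y := L \ N
  have hyY : y ∈ Y := by simp [Y, L, hy, hyX]
  have hcard : Y.card + N.card = L.card :=
    Finset.card_sdiff_add_card_eq_card fun v hv => Finset.mem_filter.2 ⟨Finset.mem_univ _, hNL v hv⟩
  have hnoedge : ∀ v ∈ X, ∀ h ∈ S, v + h ∉ Y := fun v hv h hh hm =>
    (Finset.mem_sdiff.1 hm).2 (hadd v hv h hh)
  by_cases hX2 : 2 ≤ X.card
  swap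
  · obtain ⟨v, rfl⟩ : ∃ v, X = {v} := Finset.card_eq_one.1 (by
      have := hne.card_pos
      omega)
    have hsub : insert v (S.image (v + ·)) ⊆ N := by
      intro w hw
      rcases Finset.mem_insert.1 hw with rfl | hw
      · exact hXN (by simp)
      · obtain ⟨h, hh, rfl⟩ := Finset.mem_image.1 hw
        exact hadd v (by simp) h hh
    have h1 := Finset.card_le_card hsub
    rw [Finset.card_insert_of_notMem, Finset.card_image_of_injective _ (add_right_injective v)] at h1
    · simp only [Finset.card_singleton]
      omega
    · intro hm
      obtain ⟨h, hh, he⟩ := Finset.mem_image.1 hm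
      rw [add_eq_left.1 he] at hh
      exact hS0 hh
  by_cases hY2 : 2 ≤ Y.card
  swap
  · have hYy : ∀ w ∈ Y, w = y := fun w hw => Finset.card_le_one.1 (by omega) w hw y hyY
    have hdis : Disjoint X (S.image (y + ·)) := by
      rw [Finset.disjoint_left]
      rintro v hv hm
      obtain ⟨h, hh, rfl⟩ := Finset.mem_image.1 hm
      refine hnoedge _ hv h hh ?_
      rwa [add_self_add_zmod_two]
    have hsub : X ∪ S.image (y + ·) ⊆ N := by
      intro w hw
      rcases Finset.mem_union.1 hw with hw | hw
      · exact hXN hw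
      · obtain ⟨h, hh, rfl⟩ := Finset.mem_image.1 hw
        by_contra hc
        have := hYy (y + h) (Finset.mem_sdiff.2 ⟨Finset.mem_filter.2 ⟨Finset.mem_univ _, by
          simp [hy, hS h hh]⟩, hc⟩)
        rw [add_eq_left.1 this] at hh
        exact hS0 hh
    have h1 := Finset.card_le_card hsub
    rw [Finset.card_union_of_disjoint hdis,
      Finset.card_image_of_injective _ (add_right_injective y)] at h1
    omega
  -- In dimension `Fintype.card ι - 1` this gives `N.card = L.card - Y.card ≥ X.card + 2 *
  -- Fintype.card ι - 4`, which is where `hK'` enters.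
  have hsep := (cube_separation (Finset.univ.erase i) y X Y
    (fun v hv k hk => by
      obtain rfl : k = i := by simpa using hk
      rw [hX v hv, hy])
    (fun v hv k hk => by
      obtain rfl : k = i := by simpa using hk
      rw [(Finset.mem_filter.1 (Finset.mem_sdiff.1 hv).1).2, hy])
    (Finset.disjoint_left.2 fun v hv hv' => (Finset.mem_sdiff.1 hv').2 (hXN hv))
    (fun v hv j hj => hnoedge v hv _ (hbasis j (Finset.ne_of_mem_erase hj)))).2 hX2 hY2
  have hLcard : 2 ^ Fintype.card ι ≤ 2 * L.card := by
    have h1 : (Finset.univ : Finset (ι → ZMod 2)) ⊆ L ∪ L.image (· + Pi.single i 1) := by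
      intro v _
      by_cases hv : v i = β
      · exact Finset.mem_union_left _ (by simp [L, hv])
      · refine Finset.mem_union_right _ (Finset.mem_image.2 ⟨v + Pi.single i 1, ?_,
          add_self_add_zmod_two _ _⟩)
        simp [L, ZMod.two_eq_add_one_of_ne hv, add_assoc, CharTwo.add_self_eq_zero]
    have h2 := (Finset.card_le_card h1).trans (Finset.card_union_le _ _)
    rw [Finset.card_image_of_injective _ (add_left_injective _)] at h2
    simp only [Finset.card_univ, Fintype.card_fun, ZMod.card] at h2
    omega
  have hpos : 0 < Fintype.card ι := Fintype.card_pos_iff.2 ⟨i⟩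
  rw [Finset.card_erase_of_mem (Finset.mem_univ _), Finset.card_univ] at hsep
  obtain ⟨m, hm⟩ : ∃ m, Fintype.card ι = m + 1 := ⟨_, (Nat.succ_pred_eq_of_pos hpos).symm⟩
  rw [hm] at hsep hLcard hK'
  rw [pow_succ] at hLcard
  simp only [Nat.add_sub_cancel] at hsep
  omega

end Cube

/-! ### Fans inside a layer -/

section Fans

variable {ι : Type*}

theorem cubeCayley_adj_iff {S : Finset (ι → ZMod 2)} (hS0 : 0 ∉ S) {u v : ι → ZMod 2} :
    (cubeCayley S).Adj u v ↔ u + v ∈ S := by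
  refine ⟨fun h => h.2, fun h => ⟨?_, h⟩⟩
  rintro rfl
  rw [add_self_zmod_two] at h
  exact hS0 h

theorem cubeCayley_adj_apply {S : Finset (ι → ZMod 2)} {i : ι} (hS : ∀ h ∈ S, h i = 0)
    {u v : ι → ZMod 2} (h : (cubeCayley S).Adj u v) : u i = v i :=
  CharTwo.add_eq_zero.1 (hS _ h.2)

variable [DecidableEq ι] [Fintype ι]

/-- The neighbours of `y` in the Cayley graph with connection set `S`. -/
def cubeNeighbors (S : Finset (ι → ZMod 2)) (y : ι → ZMod 2) : Finset (ι → ZMod 2) :=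
  Finset.univ.filter fun v => (cubeCayley S).Adj y v

theorem mem_cubeNeighbors {S : Finset (ι → ZMod 2)} {y v : ι → ZMod 2} :
    v ∈ cubeNeighbors S y ↔ (cubeCayley S).Adj y v := by
  simp [cubeNeighbors]

theorem card_cubeNeighbors {S : Finset (ι → ZMod 2)} (hS0 : 0 ∉ S) (y : ι → ZMod 2) :
    (cubeNeighbors S y).card = S.card := by
  rw [← Finset.card_image_of_injective S (add_right_injective y)]
  congr 1
  ext v
  rw [mem_cubeNeighbors, cubeCayley_adj_iff hS0, Finset.mem_image]
  exact ⟨fun h => ⟨_, h, add_add_self_zmod_two _ _⟩, by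
    rintro ⟨h, hh, rfl⟩
    rwa [add_add_self_zmod_two]⟩

theorem mem_cubeNbhd {S X : Finset (ι → ZMod 2)} {v : ι → ZMod 2} :
    v ∈ cubeNbhd S X ↔ ∃ u ∈ X, v = u ∨ (cubeCayley S).Adj u v := by
  simp [cubeNbhd]

/-- Inside a layer there are paths from any `K` vertices to `z` which only meet in `z`. -/
theorem exists_fan (i : ι) (β : ZMod 2) (S : Finset (ι → ZMod 2))
    (hS : ∀ h ∈ S, h i = 0) (hS0 : 0 ∉ S) (hbasis : ∀ j ≠ i, Pi.single j 1 ∈ S)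
    (hK : S.card + 4 ≤ 2 * Fintype.card ι) (z : ι → ZMod 2) (hz : z i = β)
    (T : Finset (ι → ZMod 2)) (hT : ∀ t ∈ T, t i = β) (hTK : T.card ≤ S.card) :
    ∃ Q : ∀ t : T, (cubeCayley S).Walk t.1 z, ∀ t, (Q t).IsPath ∧
      (∀ v ∈ (Q t).support, v i = β) ∧
      ∀ t', t ≠ t' → ∀ v ∈ (Q t).support, v ∈ (Q t').support → v = z := by
  let L : Finset (ι → ZMod 2) := Finset.univ.filter fun v => v i = β
  have hL : ∀ v, v ∈ L ↔ v i = β := fun v => by simp [L]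
  obtain ⟨e, P, hP⟩ := (cubeCayley S).exists_disjoint_paths (L.erase z) (T.erase z)
    (cubeNeighbors S z) (fun t ht => by
      rw [Finset.mem_erase] at ht ⊢
      exact ⟨ht.1, (hL t).2 (hT t ht.2)⟩) (by
      intro X hX
      rcases X.eq_empty_or_nonempty with rfl | hne
      · simp
      have hX' : ∀ v ∈ X, v ≠ z ∧ v i = β ∧ ¬ (cubeCayley S).Adj z v := fun v hv => by
        have := hX hv
        rw [Finset.mem_sdiff, Finset.mem_erase, hL, mem_cubeNeighbors] at this
        exact ⟨this.1.1, this.1.2, this.2⟩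
      have hzN : z ∉ cubeNbhd S X := by
        rw [mem_cubeNbhd]
        rintro ⟨u, hu, rfl | h⟩
        · exact (hX' _ hu).1 rfl
        · exact (hX' u hu).2.2 h.symm
      -- As `X` avoids `z` and its neighbours, `z` is not dominated; the surplus `S.card` pays for
      -- removing the at most `S.card` starting points in `T`.
      have h1 := card_add_le_card_cubeNbhd i β S hS hS0 hbasis le_rfl hK X
        (fun v hv => (hX' v hv).2.1) hne z hz hzN
      have h2 : cubeNbhd S X \ T.erase z ⊆ (L.erase z).filter fun v => v ∉ T.erase z ∧
          ∃ u ∈ X, v = u ∨ (cubeCayley S).Adj u v := by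
        intro v hv
        rw [Finset.mem_sdiff] at hv
        have hvX := mem_cubeNbhd.1 hv.1
        refine Finset.mem_filter.2 ⟨Finset.mem_erase.2 ⟨fun h => hzN (h ▸ hv.1), (hL v).2 ?_⟩,
          hv.2, hvX⟩
        obtain ⟨u, hu, rfl | h⟩ := hvX
        · exact (hX' _ hu).2.1
        · rw [← cubeCayley_adj_apply hS h, (hX' u hu).2.1]
      have h3 := Finset.card_le_card h2
      have h4 := Finset.le_card_sdiff (T.erase z) (cubeNbhd S X)
      have h5 := Finset.card_le_card (Finset.erase_subset z T)
      omega)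
  have key : ∀ t : T, ∃ q : (cubeCayley S).Walk t.1 z, q.IsPath ∧ (∀ v ∈ q.support, v i = β) ∧
      ∀ v ∈ q.support, v = z ∨ (t.1 ≠ z ∧ v ∈ (P t.1).support) := by
    rintro ⟨t, ht⟩
    by_cases htz : t = z
    · subst htz
      exact ⟨Walk.nil, Walk.IsPath.nil, by simpa using hz, by simp⟩
    · obtain ⟨h1, h2, h3, -⟩ := hP t (Finset.mem_erase.2 ⟨htz, ht⟩)
      have hU : ∀ v ∈ (P t).support, v ≠ z ∧ v i = β := fun v hv => by
        have := h3 v hv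
        rwa [Finset.mem_erase, hL] at this
      refine ⟨(P t).concat (mem_cubeNeighbors.1 h2).symm, h1.concat (fun h => (hU z h).1 rfl) _,
        fun v hv => ?_, fun v hv => ?_⟩ <;>
        rw [Walk.support_concat, List.mem_append, List.mem_singleton] at hv
      · rcases hv with hv | rfl
        exacts [(hU v hv).2, hz]
      · rcases hv with hv | rfl
        exacts [Or.inr ⟨htz, hv⟩, Or.inl rfl]
  choose Q h1 h2 h3 using key
  refine ⟨Q, fun t => ⟨h1 t, h2 t, fun t' hne v hv hv' => ?_⟩⟩
  by_contra hvz
  obtain ⟨ht, hvt⟩ := (h3 t v hv).resolve_left hvz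
  obtain ⟨ht', hvt'⟩ := (h3 t' v hv').resolve_left hvz
  exact (hP t.1 (Finset.mem_erase.2 ⟨ht, t.2⟩)).2.2.2 t'.1 (Finset.mem_erase.2 ⟨ht', t'.2⟩)
    (fun h => hne (Subtype.ext h)) v hvt hvt'

/-- Translation by `y` identifies the common neighbours with generators `h` for which `x + y + h` is
again a generator. -/
theorem card_common_neighbors_le {S : Finset (ι → ZMod 2)} (hS0 : 0 ∉ S) {c : ℕ}
    (x y : ι → ZMod 2) (hc : (S.filter fun h => x + y + h ∈ S).card ≤ c) :
    ((cubeNeighbors S y).filter fun a => (cubeCayley S).Adj x a).card ≤ c := by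
  refine le_trans (Finset.card_le_card_of_injOn (y + ·) (fun a ha => ?_)
    (add_right_injective y).injOn) hc
  rw [Finset.mem_coe, Finset.mem_filter, mem_cubeNeighbors, cubeCayley_adj_iff hS0,
    cubeCayley_adj_iff hS0] at ha
  refine Finset.mem_coe.2 (Finset.mem_filter.2 ⟨ha.1, ?_⟩)
  rw [add_assoc, add_add_self_zmod_two]
  exact ha.2

/-- Inside a layer there are paths from all neighbours of `y` to `x`, avoiding `y` and only meeting
in `x`. The neighbour `e a` of `x` on the path from `a` differs from `a`, and both avoid
`x + τ` and `y + τ`, with at most six exceptions. -/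
theorem exists_fan_of_neighbors (i : ι) (β : ZMod 2) (S : Finset (ι → ZMod 2))
    (hS : ∀ h ∈ S, h i = 0) (hS0 : 0 ∉ S) (hbasis : ∀ j ≠ i, Pi.single j 1 ∈ S)
    (hK : S.card + 4 ≤ 2 * Fintype.card ι) (x y τ : ι → ZMod 2) (hx : x i = β) (hy : y i = β)
    (hxy : x ≠ y) (hτ : τ ∈ S) (hc : (S.filter fun h => x + y + h ∈ S).card ≤ 4) :
    ∃ (Q : ∀ a : cubeNeighbors S y, (cubeCayley S).Walk a.1 x) (e : (ι → ZMod 2) → ι → ZMod 2),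
      (∀ a, (Q a).IsPath ∧ (∀ v ∈ (Q a).support, v i = β ∧ v ≠ y) ∧
        (∀ a', a ≠ a' → ∀ v ∈ (Q a).support, v ∈ (Q a').support → v = x) ∧
        (a.1 ≠ x → (cubeCayley S).Adj x (e a) ∧ e a ∈ (Q a).support)) ∧
      S.card ≤ ((cubeNeighbors S y).filter fun a => a ≠ x ∧ e a ≠ a ∧
        (a ≠ x + τ ∧ a ≠ y + τ) ∧ (e a ≠ x + τ ∧ e a ≠ y + τ)).card + 6 := by
  have hcard := card_cubeNeighbors hS0 y
  have hcom := card_common_neighbors_le hS0 x y hc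
  have finish : ∀ (e : (ι → ZMod 2) → ι → ZMod 2) (B : Finset (ι → ZMod 2)), B.card ≤ 6 →
      (∀ a ∈ cubeNeighbors S y, (a = x ∨ e a = a ∨ a = x + τ ∨ a = y + τ ∨ e a = x + τ ∨
        e a = y + τ) → a ∈ B) →
      S.card ≤ ((cubeNeighbors S y).filter fun a => a ≠ x ∧ e a ≠ a ∧
        (a ≠ x + τ ∧ a ≠ y + τ) ∧ (e a ≠ x + τ ∧ e a ≠ y + τ)).card + 6 := by
    intro e B hB h
    rw [← hcard]
    refine le_trans (Finset.card_le_card (t := _ ∪ B) fun a ha => ?_)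
      ((Finset.card_union_le _ _).trans (Nat.add_le_add_left hB _))
    rw [Finset.mem_union, Finset.mem_filter]
    have := h a ha
    tauto
  by_cases hadj : x + y ∈ S
  · have hN : ∀ a, a ∈ cubeNeighbors S y ↔ y + a ∈ S := fun a => by
      rw [mem_cubeNeighbors, cubeCayley_adj_iff hS0]
    have hshift : ∀ a, x + (x + y + a) = y + a := fun a => by
      rw [add_assoc, add_add_self_zmod_two]
    have happly : ∀ a, y + a ∈ S → a i = β := fun a ha =>
      (CharTwo.add_eq_zero.1 (hS _ ha)).symm.trans hy
    -- When `x` and `y` are adjacent, translation by `x + y` moves along edges and exchanges their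
    -- neighbourhoods. So the paths are explicit: a, x + y + a, x, shortened to the edge when `a` is
    -- adjacent to `x`, and trivial when `a = x`.
    have key : ∀ a : cubeNeighbors S y, ∃ q : (cubeCayley S).Walk a.1 x, q.IsPath ∧
        (∀ v ∈ q.support, v = x ∨ v = a ∨ (v = x + y + a ∧ x + a.1 ∉ S ∧ a.1 ≠ x)) ∧
        (x + a.1 ∉ S → a.1 ≠ x → x + y + a ∈ q.support) := by
      rintro ⟨a, ha⟩
      by_cases hax : a = x
      · subst hax
        exact ⟨Walk.nil, Walk.IsPath.nil, by simp, by simp⟩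
      by_cases hadj' : x + a ∈ S
      · have h : (cubeCayley S).Adj a x := ((cubeCayley_adj_iff hS0).2 hadj').symm
        exact ⟨h.toWalk, h.isPath_toWalk, by simp, fun h' => absurd hadj' h'⟩
      · have h1 : (cubeCayley S).Adj a (x + y + a) := (cubeCayley_adj_iff hS0).2 (by
          rw [add_comm, add_self_add_zmod_two]
          exact hadj)
        have h2 : (cubeCayley S).Adj (x + y + a) x := ((cubeCayley_adj_iff hS0).2 (by
          rw [hshift]
          exact (hN a).1 ha)).symm
        refine ⟨Walk.cons h1 h2.toWalk, h2.isPath_toWalk.cons ?_, ?_, ?_⟩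
        · simp only [Adj.toWalk, Walk.support_cons, Walk.support_nil, List.mem_cons,
            List.not_mem_nil, or_false, not_or]
          exact ⟨h1.ne, hax⟩
        · intro v hv
          simp only [Adj.toWalk, Walk.support_cons, Walk.support_nil, List.mem_cons,
            List.not_mem_nil, or_false] at hv
          rcases hv with rfl | rfl | rfl
          · exact Or.inr (Or.inl rfl)
          · exact Or.inr (Or.inr ⟨rfl, hadj', hax⟩)
          · exact Or.inl rfl
        · simp [Adj.toWalk]
    choose Q h1 h2 h3 using key
    let e : (ι → ZMod 2) → ι → ZMod 2 := fun a => if x + a ∈ S then a else x + y + a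
    refine ⟨Q, e, fun a => ⟨h1 a, fun v hv => ?_, fun a' hne v hv hv' => ?_, fun hax => ?_⟩, ?_⟩
    · have ha := (hN a).1 a.2
      rcases h2 a v hv with rfl | rfl | ⟨rfl, -, hax⟩
      · exact ⟨hx, hxy⟩
      · exact ⟨happly _ ha, (mem_cubeNeighbors.1 a.2).ne'⟩
      · refine ⟨by simp [hx, hy, happly _ ha, CharTwo.add_self_eq_zero], fun h => hax ?_⟩
        have h' := hshift a.1
        rw [h, add_comm x y] at h'
        exact (add_left_cancel h').symm
    · by_contra hvx
      have hne' : a.1 ≠ a'.1 := fun h => hne (Subtype.ext h)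
      rcases (h2 a v hv).resolve_left hvx with rfl | ⟨rfl, hn, -⟩ <;>
        rcases (h2 a' _ hv').resolve_left hvx with h | ⟨h, hn', -⟩
      · exact hne' h
      · refine hn' ?_
        have := (hN a.1).1 a.2
        rwa [h, add_comm x y, add_assoc, add_add_self_zmod_two] at this
      · refine hn ?_
        have := (hN a'.1).1 a'.2
        rwa [← h, add_comm x y, add_assoc, add_add_self_zmod_two] at this
      · exact hne' (add_left_cancel h)
    · by_cases hxa : x + a.1 ∈ S
      · simp only [e, if_pos hxa]
        exact ⟨(cubeCayley_adj_iff hS0).2 hxa, (Q a).start_mem_support⟩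
      · simp only [e, if_neg hxa]
        refine ⟨(cubeCayley_adj_iff hS0).2 ?_, h3 a hxa hax⟩
        rw [hshift]
        exact (hN a.1).1 a.2
    -- The six exceptions are `x`, `y + τ` and at most four common neighbours: `a = x + τ` is itself
    -- one, `e a = x + τ` forces `a = y + τ`, and `e a = y + τ` forces `a = x + τ`.
    · refine finish e (insert x (insert (y + τ)
        ((cubeNeighbors S y).filter fun a => (cubeCayley S).Adj x a)))
        ((Finset.card_insert_le _ _).trans (Nat.succ_le_succ ((Finset.card_insert_le _ _).trans
          (Nat.succ_le_succ hcom)))) fun a ha h => ?_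
      rw [Finset.mem_insert, Finset.mem_insert, Finset.mem_filter, cubeCayley_adj_iff hS0]
      have hxτ : a = x + τ → x + a ∈ S := by
        rintro rfl
        rwa [add_add_self_zmod_two]
      by_cases hxa : x + a ∈ S
      · exact Or.inr (Or.inr ⟨ha, hxa⟩)
      have hea : e a = x + y + a := if_neg hxa
      rw [hea] at h
      rcases h with h | h | h | h | h | h
      · exact Or.inl h
      · rw [add_eq_right, add_eq_zero_iff_zmod_two] at h
        exact absurd h hxy
      · exact absurd (hxτ h) hxa
      · exact Or.inr (Or.inl h)
      · rw [add_assoc] at h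
        refine Or.inr (Or.inl ?_)
        rw [← add_left_cancel h, add_add_self_zmod_two]
      · rw [add_comm x y, add_assoc] at h
        refine absurd (hxτ ?_) hxa
        rw [← add_left_cancel h, add_add_self_zmod_two]
  · let L : Finset (ι → ZMod 2) := Finset.univ.filter fun v => v i = β
    have hL : ∀ v, v ∈ L ↔ v i = β := fun v => by simp [L]
    have hxy' : ¬ (cubeCayley S).Adj x y := fun h => hadj h.2
    obtain ⟨e, P, hP⟩ := (cubeCayley S).exists_disjoint_paths ((L.erase x).erase y)
      (cubeNeighbors S y) (cubeNeighbors S x) (fun t ht => by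
        rw [mem_cubeNeighbors] at ht
        rw [Finset.mem_erase, Finset.mem_erase, hL]
        exact ⟨ht.ne', fun h => hxy' (h ▸ ht.symm), (cubeCayley_adj_apply hS ht).symm.trans hy⟩) (by
        intro X hX
        have hX' : ∀ v ∈ X, v ≠ y ∧ v ≠ x ∧ v i = β ∧ ¬ (cubeCayley S).Adj x v := fun v hv => by
          have := hX hv
          rw [Finset.mem_sdiff, Finset.mem_erase, Finset.mem_erase, hL, mem_cubeNeighbors] at this
          exact ⟨this.1.1, this.1.2.1, this.1.2.2, this.2⟩
        have hxN : x ∉ cubeNbhd S (insert y X) := by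
          rw [mem_cubeNbhd]
          rintro ⟨u, hu, h⟩
          rcases Finset.mem_insert.1 hu with rfl | hu
          · exact h.elim hxy fun h => hxy' h.symm
          · exact h.elim (fun h => (hX' u hu).2.1 h.symm) fun h => (hX' u hu).2.2.2 h.symm
        have hXβ : ∀ v ∈ insert y X, v i = β := fun v hv => by
          rcases Finset.mem_insert.1 hv with rfl | hv
          exacts [hy, (hX' v hv).2.2.1]
        -- Adding `y` to `X` makes the count exact: the expansion gives `X.card + 1 + S.card`
        -- vertices, and deleting `y` with its `S.card` neighbours leaves at least `X.card`.
        have h1 := card_add_le_card_cubeNbhd i β S hS hS0 hbasis le_rfl hK (insert y X)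
          hXβ (Finset.insert_nonempty _ _) x hx hxN
        rw [Finset.card_insert_of_notMem fun h => (hX' y h).1 rfl] at h1
        have h2 : cubeNbhd S (insert y X) \ insert y (cubeNeighbors S y) ⊆
            ((L.erase x).erase y).filter fun v => v ∉ cubeNeighbors S y ∧
              ∃ u ∈ X, v = u ∨ (cubeCayley S).Adj u v := by
          intro v hv
          rw [Finset.mem_sdiff, Finset.mem_insert, not_or] at hv
          have hvX := mem_cubeNbhd.1 hv.1
          refine Finset.mem_filter.2 ⟨Finset.mem_erase.2 ⟨hv.2.1, Finset.mem_erase.2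
            ⟨fun h => hxN (h ▸ hv.1), (hL v).2 ?_⟩⟩, hv.2.2, ?_⟩
          · obtain ⟨u, hu, rfl | h⟩ := hvX
            · exact hXβ _ hu
            · rw [← cubeCayley_adj_apply hS h, hXβ u hu]
          · obtain ⟨u, hu, h⟩ := hvX
            rcases Finset.mem_insert.1 hu with rfl | hu
            · exact (h.elim hv.2.1 fun h => hv.2.2 (mem_cubeNeighbors.2 h)).elim
            · exact ⟨u, hu, h⟩
        have h3 := Finset.card_le_card h2
        have h4 := Finset.le_card_sdiff (insert y (cubeNeighbors S y)) (cubeNbhd S (insert y X))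
        have h5 := Finset.card_insert_le y (cubeNeighbors S y)
        omega)
    have hU : ∀ a ∈ cubeNeighbors S y, ∀ v ∈ (P a).support, v ≠ y ∧ v ≠ x ∧ v i = β :=
      fun a ha v hv => by
        have := (hP a ha).2.2.1 v hv
        rwa [Finset.mem_erase, Finset.mem_erase, hL] at this
    refine ⟨fun a => (P a.1).concat (mem_cubeNeighbors.1 (hP a.1 a.2).2.1).symm, e,
      fun a => ⟨(hP a.1 a.2).1.concat (fun h => (hU a.1 a.2 x h).2.1 rfl) _, fun v hv => ?_,
        fun a' hne v hv hv' => ?_, fun _ => ⟨mem_cubeNeighbors.1 (hP a.1 a.2).2.1, ?_⟩⟩, ?_⟩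
    · rw [Walk.support_concat, List.mem_append, List.mem_singleton] at hv
      rcases hv with hv | rfl
      · exact ⟨(hU a.1 a.2 v hv).2.2, (hU a.1 a.2 v hv).1⟩
      · exact ⟨hx, hxy⟩
    · rw [Walk.support_concat, List.mem_append, List.mem_singleton] at hv hv'
      by_contra hvx
      exact (hP a.1 a.2).2.2.2 a'.1 a'.2 (fun h => hne (Subtype.ext h)) v (hv.resolve_right hvx)
        (hv'.resolve_right hvx)
    · rw [Walk.support_concat, List.mem_append]
      exact Or.inl (P a.1).end_mem_support
    · have hone : ∀ w : ι → ZMod 2,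
          ((cubeNeighbors S y).filter fun a => w ∈ (P a).support).card ≤ 1 := fun w => by
        refine Finset.card_le_one.2 fun a ha a' ha' => ?_
        rw [Finset.mem_filter] at ha ha'
        by_contra hne
        exact (hP a ha.1).2.2.2 a' ha'.1 hne w ha.2 ha'.2
      -- The six exceptions are at most four common neighbours, which covers `e a = a`, and at most
      -- one path through each of `x + τ` and `y + τ`.
      refine finish e (((cubeNeighbors S y).filter fun a => (cubeCayley S).Adj x a) ∪
        (((cubeNeighbors S y).filter fun a => x + τ ∈ (P a).support) ∪
        ((cubeNeighbors S y).filter fun a => y + τ ∈ (P a).support)))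
        ((Finset.card_union_le _ _).trans (Nat.add_le_add hcom ((Finset.card_union_le _ _).trans
          (Nat.add_le_add (hone _) (hone _))))) fun a ha h => ?_
      rw [Finset.mem_union, Finset.mem_union, Finset.mem_filter, Finset.mem_filter,
        Finset.mem_filter]
      have hs := (P a).start_mem_support
      have he := (P a).end_mem_support
      have hxe := mem_cubeNeighbors.1 (hP a ha).2.1
      rcases h with h | h | h | h | h | h
      · exact absurd h (hU a ha a hs).2.1
      · exact Or.inl ⟨ha, by rwa [h] at hxe⟩
      · exact Or.inr (Or.inl ⟨ha, h ▸ hs⟩)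
      · exact Or.inr (Or.inr ⟨ha, h ▸ hs⟩)
      · exact Or.inr (Or.inl ⟨ha, h ▸ he⟩)
      · exact Or.inr (Or.inr ⟨ha, h ▸ he⟩)

end Fans

/-! ### The lower bound for three vertices split by a coordinate -/

theorem cubeCayley_mono {ι : Type*} {S T : Finset (ι → ZMod 2)} (h : S ⊆ T) :
    cubeCayley S ≤ cubeCayley T := fun _ _ huv => ⟨huv.1, h huv.2⟩

section LowerBound

variable {ι : Type*} [DecidableEq ι] [Fintype ι]

/-- Suppose that the coordinate `i` separates `z` from `x` and `y`. Take the fan from the neighbours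
of `y` to `x` in their layer, cut some of its paths at both ends, and continue the ends, as well as
`x, y, x + τ, y + τ`, by a fan to `z` in the other layer. -/
theorem hasInternallyDisjointPaths_cubeCayley (S₀ S : Finset (ι → ZMod 2)) (hS₀ : 0 ∉ S₀)
    (hSS : S ⊆ S₀) (i : ι) (hS : ∀ h ∈ S, h i = 0) (hbasis : ∀ j ≠ i, Pi.single j 1 ∈ S)
    {s : ℕ} (hn : Fintype.card ι = 2 * s + 4) (hK : S.card + 4 = 2 * Fintype.card ι)
    (hi : Pi.single i 1 ∈ S₀) (τ : ι → ZMod 2) (hτ : τ ∈ S) (hiτ : Pi.single i 1 + τ ∈ S₀)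
    {x y z : ι → ZMod 2} (hxy : x ≠ y) (hxyi : x i = y i) (hzi : z i ≠ x i) (hxyτ : x + y ≠ τ)
    (hc : (S.filter fun h => x + y + h ∈ S).card ≤ 4) :
    HasInternallyDisjointPaths (cubeCayley S₀) {x, y, z} ((s + 2) + ((s + 2) + s)) := by
  have hS0 : 0 ∉ S := fun h => hS₀ (hSS h)
  have hle := cubeCayley_mono hSS
  have hzx : z i = x i + 1 := ZMod.two_eq_add_one_of_ne hzi
  obtain ⟨R, e, hR, hgood⟩ := exists_fan_of_neighbors i (x i) S hS hS0 hbasis hK.le x y τ rfl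
    hxyi.symm hxy hτ hc
  -- At least 4s + 4 - 6 paths can be cut; this is at least 2s when s ≥ 1, and none is needed when s
  -- = 0.
  obtain ⟨J, hJ, hJcard⟩ := Finset.exists_subset_card_eq (n := 2 * s) (s := (cubeNeighbors S y).filter
    fun a => a ≠ x ∧ e a ≠ a ∧ (a ≠ x + τ ∧ a ≠ y + τ) ∧ (e a ≠ x + τ ∧ e a ≠ y + τ)) (by omega)
  have hJN : ∀ a ∈ J, a ∈ cubeNeighbors S y := fun a ha => (Finset.mem_filter.1 (hJ ha)).1
  have hJx : ∀ a ∈ J, a ≠ x := fun a ha => (Finset.mem_filter.1 (hJ ha)).2.1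
  have hJe : ∀ a ∈ J, e a ≠ a := fun a ha => (Finset.mem_filter.1 (hJ ha)).2.2.1
  have hJτ : ∀ a ∈ J, (a ≠ x + τ ∧ a ≠ y + τ) ∧ (e a ≠ x + τ ∧ e a ≠ y + τ) :=
    fun a ha => (Finset.mem_filter.1 (hJ ha)).2.2.2
  have hRpath := fun a => (hR a).1
  have hRi : ∀ a, ∀ v ∈ (R a).support, v i = x i := fun a v hv => ((hR a).2.1 v hv).1
  have hRy : ∀ a, ∀ v ∈ (R a).support, v ≠ y := fun a v hv => ((hR a).2.1 v hv).2
  have hRR : ∀ a a', a ≠ a' → ∀ v ∈ (R a).support, v ∈ (R a').support → v = x :=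
    fun a => (hR a).2.2.1
  have hxe : ∀ a (ha : a ∈ J), (cubeCayley S).Adj x (e a) :=
    fun a ha => ((hR ⟨a, hJN a ha⟩).2.2.2 (hJx a ha)).1
  have heR : ∀ a (ha : a ∈ J), e a ∈ (R ⟨a, hJN a ha⟩).support :=
    fun a ha => ((hR ⟨a, hJN a ha⟩).2.2.2 (hJx a ha)).2
  have haR : ∀ a (ha : a ∈ J), a ∈ (R ⟨a, hJN a ha⟩).support :=
    fun a ha => (R ⟨a, hJN a ha⟩).start_mem_support
  have hτi : τ i = 0 := hS τ hτ
  have hτ0 : τ ≠ 0 := fun h => hS0 (h ▸ hτ)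
  let cx : Bool → ι → ZMod 2 := fun b => cond b (x + τ) x
  let cy : Bool → ι → ZMod 2 := fun b => cond b (y + τ) y
  -- These 4s + 4 distinct points, shifted across the layers, are the starts of the fan to `z`. The
  -- points `x + τ` and `y + τ` only label starts: their shifts are adjacent to `x` and `y`
  -- directly, so the connectors to `z` do not visit them.
  let p : (J ⊕ Bool) ⊕ (J ⊕ Bool) → ι → ZMod 2 :=
    Sum.elim (Sum.elim (fun a => e a) cx) (Sum.elim (fun a => a) cy)
  have hsame : ∀ a (ha : a ∈ J) a' (ha' : a' ∈ J) v, v ≠ x →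
      v ∈ (R ⟨a, hJN a ha⟩).support → v ∈ (R ⟨a', hJN a' ha'⟩).support → a = a' := by
    intro a ha a' ha' v hvx hv hv'
    by_contra hne
    exact hvx (hRR _ _ (fun h => hne (congrArg Subtype.val h)) v hv hv')
  have hcond : ∀ w : ι → ZMod 2, Function.Injective fun b : Bool => cond b (w + τ) w := fun w =>
    Bool.injective_iff.2 fun h => hτ0 (left_eq_add.1 h)
  have hpinj : Function.Injective p := by
    refine Function.Injective.sumElim (Function.Injective.sumElim ?_ ?_ ?_)
      (Function.Injective.sumElim Subtype.val_injective ?_ ?_) ?_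
    · rintro ⟨a, ha⟩ ⟨a', ha'⟩ h
      have h : e a = e a' := h
      exact Subtype.ext (hsame a ha a' ha' (e a) (hxe a ha).ne' (heR a ha) (h ▸ heR a' ha'))
    · exact hcond x
    · rintro ⟨a, ha⟩ (_ | _)
      exacts [(hxe a ha).ne', (hJτ a ha).2.1]
    · exact hcond y
    · rintro ⟨a, ha⟩ (_ | _)
      exacts [(mem_cubeNeighbors.1 (hJN a ha)).ne', (hJτ a ha).1.2]
    · rintro (⟨a, ha⟩ | _ | _) (⟨a', ha'⟩ | _ | _)
      · intro h
        have h : e a = a' := h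
        have := hsame a ha a' ha' (e a) (hxe a ha).ne' (heR a ha) (h ▸ haR a' ha')
        exact hJe a ha (h.trans this.symm)
      · exact hRy _ _ (heR a ha)
      · exact (hJτ a ha).2.2
      · exact (hJx a' ha').symm
      · exact hxy
      · intro h
        have h : x = y + τ := h
        exact hxyτ (by rw [h, add_comm, add_add_self_zmod_two])
      · exact (hJτ a' ha').1.1.symm
      · intro h
        have h : x + τ = y := h
        exact hxyτ (by rw [← h, add_add_self_zmod_two])
      · exact fun h => hxy (add_right_cancel (b := τ) h)
  have hpi : ∀ c, p c i = x i := by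
    rintro ((⟨a, ha⟩ | _ | _) | (⟨a, ha⟩ | _ | _))
    · exact hRi _ _ (heR a ha)
    · rfl
    · simp [p, cx, hτi]
    · exact hRi _ _ (haR a ha)
    · exact hxyi.symm
    · simp [p, cy, hτi, hxyi]
  let tgt : (J ⊕ Bool) ⊕ (J ⊕ Bool) → ι → ZMod 2 := fun c => p c + Pi.single i 1
  have htinj : Function.Injective tgt := fun c c' h => hpinj (add_right_cancel h)
  let T : Finset (ι → ZMod 2) := Finset.univ.image tgt
  have hTcard : T.card ≤ S.card := by
    refine Finset.card_image_le.trans ?_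
    simp only [Finset.card_univ, Fintype.card_sum, Fintype.card_coe, Fintype.card_bool, hJcard]
    omega
  obtain ⟨Q, hQ⟩ := exists_fan i (z i) S hS hS0 hbasis hK.le z rfl T (fun t ht => by
    obtain ⟨c, -, rfl⟩ := Finset.mem_image.1 ht
    simp [tgt, hpi c, hzx]) hTcard
  have hmemT : ∀ c, tgt c ∈ T := fun c => Finset.mem_image_of_mem _ (Finset.mem_univ c)
  let q : ∀ c, (cubeCayley S₀).Walk (tgt c) z := fun c => (Q ⟨tgt c, hmemT c⟩).mapLe hle
  have hqpath : ∀ c, (q c).IsPath := fun c => (Walk.isPath_mapLe hle).2 (hQ _).1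
  have hqi : ∀ c, ∀ v ∈ (q c).support, v i = z i := fun c v hv => by
    rw [Walk.support_mapLe_eq_support] at hv
    exact (hQ _).2.1 v hv
  have hqq : ∀ c c', c ≠ c' → ∀ v ∈ (q c).support, v ∈ (q c').support → v = z :=
    fun c c' hne v hv hv' => by
      rw [Walk.support_mapLe_eq_support] at hv hv'
      exact (hQ _).2.2 _ (fun h => hne (htinj (congrArg Subtype.val h))) v hv hv'
  -- Interior vertices of the connectors to `z` in the layer of `x` and `y`: one end of a cut path,
  -- or nothing for the direct crossings.
  let extra : (J ⊕ Bool) ⊕ (J ⊕ Bool) → Set (ι → ZMod 2) :=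
    Sum.elim (Sum.elim (fun a => {e a}) fun _ => ∅) (Sum.elim (fun a => {a.1}) fun _ => ∅)
  have hextra : ∀ c, ∀ v ∈ extra c, v = p c ∧ v ≠ x ∧ v ≠ y ∧
      ∃ (a : _) (ha : a ∈ J), v ∈ (R ⟨a, hJN a ha⟩).support := by
    rintro ((⟨a, ha⟩ | b) | (⟨a, ha⟩ | b)) v hv
    · obtain rfl : v = e a := hv
      exact ⟨rfl, (hxe a ha).ne', hRy _ _ (heR a ha), a, ha, heR a ha⟩
    · exact absurd hv (Set.notMem_empty v)
    · obtain rfl : v = a := hv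
      exact ⟨rfl, hJx _ ha, hRy _ _ (haR _ ha), _, ha, haR _ ha⟩
    · exact absurd hv (Set.notMem_empty v)
  have hextrai : ∀ c, ∀ v ∈ extra c, v i = x i := fun c v hv => by
    rw [(hextra c v hv).1, hpi]
  let X : {a // a ∈ cubeNeighbors S y \ J} ⊕ (J ⊕ Bool) ⊕ (J ⊕ Bool) → Set (ι → ZMod 2) :=
    Sum.elim (fun a => {w | w ∈ (R ⟨a, (Finset.mem_sdiff.1 a.2).1⟩).support ∧ w ≠ x})
      fun c => extra c ∪ {w | w ∈ (q c).support ∧ w ≠ z}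
  have hadjp : ∀ c, (cubeCayley S₀).Adj (p c) (tgt c) := fun c => by
    rw [cubeCayley_adj_iff hS₀, add_add_self_zmod_two]
    exact hi
  have hadjτ : ∀ w : ι → ZMod 2, (cubeCayley S₀).Adj w (w + τ + Pi.single i 1) := fun w => by
    rw [cubeCayley_adj_iff hS₀, add_assoc, add_add_self_zmod_two, add_comm]
    exact hiτ
  have hlong : ∀ u, u i = x i → ∀ c, (cubeCayley S₀).Adj u (p c) →
      (cubeCayley S₀).IsConnector u z ({p c} ∪ {w | w ∈ (q c).support ∧ w ≠ z}) := by
    intro u hu c hup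
    have h := isConnector_cons hup (Walk.cons (hadjp c) (q c))
      ((hqpath c).cons fun h => hzi ((hqi c _ h).symm.trans (hpi c))) (by
        rw [Walk.support_cons, List.mem_cons, not_or]
        exact ⟨hup.ne, fun h => hzi ((hqi c _ h).symm.trans hu)⟩)
    convert h using 1
    ext w
    simp only [Walk.support_cons, List.mem_cons, Set.mem_union, Set.mem_singleton_iff,
      Set.mem_ofPred_eq]
    have : p c ≠ z := fun h => hzi (h ▸ hpi c)
    constructor
    · rintro (rfl | h)
      exacts [⟨Or.inl rfl, this⟩, ⟨Or.inr h.1, h.2⟩]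
    · rintro ⟨rfl | h, h'⟩
      exacts [Or.inl rfl, Or.inr ⟨h, h'⟩]
  have hshort : ∀ u, u i = x i → ∀ c, (cubeCayley S₀).Adj u (tgt c) →
      (cubeCayley S₀).IsConnector u z (∅ ∪ {w | w ∈ (q c).support ∧ w ≠ z}) := by
    intro u hu c hut
    rw [Set.empty_union]
    exact isConnector_cons hut (q c) (hqpath c) fun h => hzi ((hqi c _ h).symm.trans hu)
  have hRextra : ∀ (a : {a // a ∈ cubeNeighbors S y \ J}) c,
      Disjoint (X (.inl a)) (X (.inr c)) := by
    rintro ⟨a, ha⟩ c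
    rw [Set.disjoint_left]
    rintro v ⟨hv, hvx⟩ (hv' | ⟨hv', -⟩)
    · obtain ⟨-, -, -, a', ha', hva'⟩ := hextra c v hv'
      refine hvx (hRR _ _ (fun h => (Finset.mem_sdiff.1 ha).2 ?_) v hv hva')
      rw [show a = a' from congrArg Subtype.val h]
      exact ha'
    · exact hzi ((hqi c v hv').symm.trans (hRi _ v hv))
  -- Since the landing points are distinct, at most one connector to `z` has empty interior.
  have hempty : ∀ c, X (.inr c) = ∅ → tgt c = z := fun c hc => by
    by_contra hne
    have : tgt c ∈ X (.inr c) := Or.inr ⟨(q c).start_mem_support, hne⟩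
    rw [hc] at this
    exact this
  refine hasInternallyDisjointPaths_of_three_families hxy (fun h => hzi (h ▸ rfl))
    (fun h => hzi (by rw [hxyi, h])) (I := {a // a ∈ cubeNeighbors S y \ J}) (J := J ⊕ Bool)
    (K := J ⊕ Bool) ?_ ?_ ?_ X ?_ ?_ ?_ ?_ ?_ ?_ ?_ ?_
  · rw [Fintype.card_coe, Finset.card_sdiff_of_subset hJN, card_cubeNeighbors hS0, hJcard]
    omega
  · simp only [Fintype.card_sum, Fintype.card_coe, Fintype.card_bool, hJcard]
    omega
  · simp only [Fintype.card_sum, Fintype.card_coe, Fintype.card_bool, hJcard]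
    omega
  · rintro (a | c) (a' | c') hne
    · rw [Set.disjoint_left]
      rintro v ⟨hv, hvx⟩ ⟨hv', -⟩
      exact hvx (hRR _ _ (fun h => hne (congrArg Sum.inl (Subtype.ext (Subtype.mk.inj h))))
        v hv hv')
    · exact hRextra a c'
    · exact (hRextra a' c).symm
    · have hne : c ≠ c' := fun h => hne (congrArg Sum.inr h)
      rw [Set.disjoint_left]
      rintro v (hv | ⟨hv, hvz⟩) (hv' | ⟨hv', -⟩)
      · exact hne (hpinj ((hextra c v hv).1.symm.trans (hextra c' v hv').1))
      · exact hzi ((hqi c' v hv').symm.trans (hextrai c v hv))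
      · exact hzi ((hqi c v hv).symm.trans (hextrai c' v hv'))
      · exact hvz (hqq c c' hne v hv hv')
  · rintro (a | c) v hv
    · obtain ⟨hv, hvx⟩ := hv
      exact ⟨hvx, hRy _ v hv, fun h => hzi (h ▸ hRi _ v hv)⟩
    · rcases hv with hv | ⟨hv, hvz⟩
      · obtain ⟨-, h1, h2, -⟩ := hextra c v hv
        exact ⟨h1, h2, fun h => hzi (h ▸ hextrai c v hv)⟩
      · exact ⟨fun h => hzi (h ▸ (hqi c v hv).symm),
          fun h => hzi ((hqi c v hv).symm.trans (by rw [h, hxyi])), hvz⟩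
  · rintro ⟨a, ha⟩
    have haN := (Finset.mem_sdiff.1 ha).1
    have h := isConnector_cons (hle (mem_cubeNeighbors.1 haN)) ((R ⟨a, haN⟩).mapLe hle)
      ((Walk.isPath_mapLe hle).2 (hRpath _)) (by
        rw [Walk.support_mapLe_eq_support]
        exact fun h => hRy _ _ h rfl)
    simp only [Walk.support_mapLe_eq_support] at h
    exact h.symm
  · rintro (⟨a, ha⟩ | _ | _)
    · exact hlong x rfl (.inl (.inl ⟨a, ha⟩)) (hle (hxe a ha))
    · exact hshort x rfl (.inl (.inr false)) (hadjp (.inl (.inr false)))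
    · exact hshort x rfl (.inl (.inr true)) (hadjτ x)
  · rintro (⟨a, ha⟩ | _ | _)
    · exact hlong y hxyi.symm (.inr (.inl ⟨a, ha⟩)) (hle (mem_cubeNeighbors.1 (hJN a ha)))
    · exact hshort y hxyi.symm (.inr (.inr false)) (hadjp (.inr (.inr false)))
    · exact hshort y hxyi.symm (.inr (.inr true)) (hadjτ y)
  · have h : ∀ a : {a // a ∈ cubeNeighbors S y \ J}, X (.inl a) = ∅ → a.1 = x := fun a ha => by
      by_contra hne
      have : a.1 ∈ X (.inl a) := ⟨(R ⟨a, _⟩).start_mem_support, hne⟩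
      rw [ha] at this
      exact this
    exact fun a a' hne ha ha' => hne (Subtype.ext ((h a ha).trans (h a' ha').symm))
  · exact fun c c' hne hc hc' => hne (by
      simpa using htinj ((hempty _ hc).trans (hempty _ hc').symm))
  · exact fun c c' hne hc hc' => hne (by
      simpa using htinj ((hempty _ hc).trans (hempty _ hc').symm))

end LowerBound

/-! ### The generators of the augmented cube and the choice of the splitting coordinate -/

section Generators

variable {n : ℕ}

/-- The connection set of the augmented cube in suitable coordinates: the unit vectors and the
sums of two consecutive unit vectors. -/
def augGens (n : ℕ) : Finset (Fin n → ZMod 2) :=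
  (Finset.univ.image fun j => Pi.single j 1) ∪
    (Finset.univ.filter fun p : Fin n × Fin n => p.1.val + 1 = p.2.val).image
      fun p => Pi.single p.1 1 + Pi.single p.2 1

theorem mem_augGens {h : Fin n → ZMod 2} : h ∈ augGens n ↔ (∃ j, h = Pi.single j 1) ∨
    ∃ j k : Fin n, j.val + 1 = k.val ∧ h = Pi.single j 1 + Pi.single k 1 := by
  simp only [augGens, Finset.mem_union, Finset.mem_image, Finset.mem_univ, true_and,
    Finset.mem_filter, Prod.exists, eq_comm]

theorem single_mem_augGens (j : Fin n) : Pi.single j 1 ∈ augGens n :=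
  mem_augGens.2 (Or.inl ⟨j, rfl⟩)

theorem single_add_single_mem_augGens {j k : Fin n} (h : j.val + 1 = k.val) :
    Pi.single j 1 + Pi.single k 1 ∈ augGens n := mem_augGens.2 (Or.inr ⟨j, k, h, rfl⟩)

theorem single_injective_zmod_two :
    Function.Injective fun j : Fin n => (Pi.single j 1 : Fin n → ZMod 2) := by
  intro j k h
  by_contra hne
  have := congrFun h j
  simp [hne] at this

theorem zero_notMem_augGens : 0 ∉ augGens n := by
  intro h
  rcases mem_augGens.1 h with ⟨j, hj⟩ | ⟨j, k, hjk, hj⟩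
  · have := congrFun hj j
    simp at this
  · have hne : j ≠ k := fun h => by
      rw [h] at hjk
      omega
    have := congrFun hj j
    simp [hne] at this

theorem card_augGens (m : ℕ) : (augGens (m + 1)).card = 2 * m + 1 := by
  have hd : ((Finset.univ.filter fun p : Fin (m + 1) × Fin (m + 1) => p.1.val + 1 = p.2.val).image
      fun p => (Pi.single p.1 1 + Pi.single p.2 1 : Fin (m + 1) → ZMod 2)) =
      Finset.univ.image fun j : Fin m => Pi.single j.castSucc 1 + Pi.single j.succ 1 := by
    ext h
    simp only [Finset.mem_image, Finset.mem_filter, Finset.mem_univ, true_and, Prod.exists]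
    constructor
    · rintro ⟨j, k, hjk, rfl⟩
      refine ⟨⟨j, by omega⟩, ?_⟩
      congr 2
      exact Fin.ext hjk
    · rintro ⟨j, rfl⟩
      exact ⟨_, _, by simp, rfl⟩
  rw [augGens, hd, Finset.card_union_of_disjoint,
    Finset.card_image_of_injective _ single_injective_zmod_two, Finset.card_image_of_injective]
  · simp only [Finset.card_univ, Fintype.card_fin]
    omega
  · have key : ∀ j k : Fin m, (Pi.single j.castSucc 1 + Pi.single j.succ 1 : Fin (m + 1) → ZMod 2) =
        Pi.single k.castSucc 1 + Pi.single k.succ 1 → j.val = k.val ∨ j.val = k.val + 1 := by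
      intro j k h
      by_contra hne
      rw [not_or] at hne
      have := congrFun h j.castSucc
      simp [Fin.ext_iff, hne.1, hne.2] at this
    intro j k h
    have h1 := key j k h
    have h2 := key k j h.symm
    exact Fin.ext (by omega)
  · rw [Finset.disjoint_left]
    intro h h1 h2
    obtain ⟨l, -, rfl⟩ := Finset.mem_image.1 h1
    obtain ⟨j, -, hj⟩ := Finset.mem_image.1 h2
    have e1 := congrFun hj j.castSucc
    have e2 := congrFun hj j.succ
    simp only [Pi.add_apply, Pi.single_apply, Fin.ext_iff, Fin.val_castSucc, Fin.val_succ] at e1 e2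
    by_cases h3 : j.val = l.val
    · simp [h3] at e2
    · simp [h3] at e1

/-- At most three of the 2m + 1 generators involve coordinate `i`: the unit vector and its sums with
the two neighbouring ones. -/
theorem card_augGens_filter (m : ℕ) (i : Fin (m + 1)) :
    2 * m ≤ ((augGens (m + 1)).filter fun h => h i = 0).card + 2 := by
  have h1 := Finset.card_filter_add_card_filter_not (s := augGens (m + 1)) fun h => h i = 0
  rw [card_augGens] at h1
  -- At the two ends of the coordinate range `up` or `dn` falls back to `i`; this merely adds a
  -- spurious element to a set used as an upper bound.
  let up : Fin (m + 1) := if h : i.val + 1 < m + 1 then ⟨i + 1, h⟩ else i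
  let dn : Fin (m + 1) := ⟨i.val - 1, by omega⟩
  have h2 : ((augGens (m + 1)).filter fun h => ¬ h i = 0) ⊆
      {Pi.single i 1, Pi.single i 1 + Pi.single up 1, Pi.single dn 1 + Pi.single i 1} := by
    intro h hh
    rw [Finset.mem_filter, mem_augGens] at hh
    obtain ⟨⟨j, rfl⟩ | ⟨j, k, hjk, rfl⟩, hi⟩ := hh
    · have : i = j := by
        by_contra hne
        simp [hne] at hi
      simp [this]
    · have : i = j ∨ i = k := by
        by_contra hne
        rw [not_or] at hne
        simp [hne.1, hne.2] at hi
      rcases this with rfl | rfl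
      · have : up = k := by
          simp only [up]
          rw [dif_pos (by omega)]
          exact Fin.ext hjk
        simp [this]
      · have : dn = j := Fin.ext (by
          simp only [dn]
          omega)
        simp [this]
  have h3 := Finset.card_le_card h2
  have h4 := Finset.card_le_three (a := (Pi.single i 1 : Fin (m + 1) → ZMod 2))
    (b := Pi.single i 1 + Pi.single up 1) (c := Pi.single dn 1 + Pi.single i 1)
  omega

/-- Two different vertices of the augmented cube have at most four common neighbours. -/
theorem card_augGens_filter_add_mem_le {g : Fin n → ZMod 2} (hg : g ≠ 0) :
    ((augGens n).filter fun h => g + h ∈ augGens n).card ≤ 4 := by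
  have hne : (Finset.univ.filter fun j => g j ≠ 0).Nonempty := by
    by_contra hc
    rw [Finset.not_nonempty_iff_eq_empty, Finset.filter_eq_empty_iff] at hc
    exact hg (funext fun j => not_not.1 (hc (Finset.mem_univ j)))
  obtain ⟨j, hj, hmax⟩ : ∃ j, g j ≠ 0 ∧ ∀ k, j < k → g k = 0 := by
    refine ⟨_, (Finset.mem_filter.1 (Finset.max'_mem _ hne)).2, fun k hk => ?_⟩
    by_contra hc
    exact absurd (Finset.le_max' _ k (Finset.mem_filter.2 ⟨Finset.mem_univ _, hc⟩)) (not_le.2 hk)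
  have hj1 : g j = 1 := by
    simpa using ZMod.two_eq_add_one_of_ne hj
  let up : Fin n := if h : j.val + 1 < n then ⟨j + 1, h⟩ else j
  let dn : Fin n := ⟨j.val - 1, by omega⟩
  let α : Fin n → ZMod 2 := Pi.single dn 1 + Pi.single j 1
  let β : Fin n → ZMod 2 :=
    if g = Pi.single j 1 then Pi.single j 1 + Pi.single up 1 else Pi.single j 1
  -- Here `j` is the last coordinate in the support of `g`. If `h` is e_j + e_{j+1}, then `g + h`
  -- ends at j + 1 and vanishes at j, so it is e_{j+1} and `g` is e_j; but then `h` cannot be e_j,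
  -- as `g + h` would be 0. So only one of these two candidates survives, besides e_{j-1} + e_j.
  have claim : ∀ h ∈ augGens n, g + h ∈ augGens n → h j ≠ 0 → h = α ∨ h = β := by
    intro h hh hgh hhj
    rcases mem_augGens.1 hh with ⟨l, rfl⟩ | ⟨l, k, hlk, rfl⟩
    · obtain rfl : j = l := by
        by_contra hne
        simp [hne] at hhj
      refine Or.inr ?_
      by_cases hgj : g = Pi.single j 1
      · rw [hgj, add_self_zmod_two] at hgh
        exact absurd hgh zero_notMem_augGens
      · simp [β, hgj]
    · have : j = l ∨ j = k := by
        by_contra hne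
        rw [not_or] at hne
        simp [hne.1, hne.2] at hhj
      rcases this with rfl | rfl
      · have hup : up = k := by
          simp only [up]
          rw [dif_pos (by omega)]
          exact Fin.ext hlk
        have hgk : g k = 0 := hmax k (Fin.lt_def.2 (by omega))
        have hjk : j ≠ k := fun h => by
          rw [h] at hlk
          omega
        suffices hgj : g = Pi.single j 1 by
          right
          simp [β, hgj, hup]
        have ek : (g + (Pi.single j 1 + Pi.single k 1) : Fin n → ZMod 2) k = 1 := by
          simp [hgk, hjk.symm]
        have ej : (g + (Pi.single j 1 + Pi.single k 1) : Fin n → ZMod 2) j = 0 := by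
          simp [hj1, hjk, CharTwo.add_self_eq_zero]
        have eup : ∀ q, k < q → (g + (Pi.single j 1 + Pi.single k 1) : Fin n → ZMod 2) q = 0 := by
          intro q hq
          have hjq : j < q := Fin.lt_def.2 (by
            have := Fin.lt_def.1 hq
            omega)
          simp [hmax q hjq, hq.ne', hjq.ne']
        rcases mem_augGens.1 hgh with ⟨q, hq⟩ | ⟨q, r, hqr, hq⟩
        · rw [hq] at ek
          obtain rfl : k = q := by
            by_contra hne
            simp [hne] at ek
          rw [← add_assoc] at hq
          rw [← add_eq_zero_iff_zmod_two]
          exact add_eq_right.1 hq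
        · have hqr' : q ≠ r := fun h => by
            rw [h] at hqr
            omega
          rw [hq] at ek ej eup
          have : k = q ∨ k = r := by
            by_contra hne
            rw [not_or] at hne
            simp [hne.1, hne.2] at ek
          rcases this with rfl | rfl
          · have := eup r (Fin.lt_def.2 (by omega))
            simp [hqr'.symm] at this
          · obtain rfl : j = q := Fin.ext (by omega)
            simp [hjk] at ej
      · have hdn : dn = l := Fin.ext (by
          simp only [dn]
          omega)
        left
        simp [α, hdn]
  -- Since `g j = 1`, exactly one of `h` and `g + h` is nonzero at `j`, and `claim` applies to that
  -- one.
  have hsub : ((augGens n).filter fun h => g + h ∈ augGens n) ⊆ {α, β, g + α, g + β} := by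
    intro h hh
    rw [Finset.mem_filter] at hh
    simp only [Finset.mem_insert, Finset.mem_singleton]
    by_cases hhj : h j = 0
    · have := claim (g + h) hh.2 (by rw [add_add_self_zmod_two]; exact hh.1) (by simp [hhj, hj1])
      rcases this with h' | h'
      · exact Or.inr (Or.inr (Or.inl (by rw [← h', add_add_self_zmod_two])))
      · exact Or.inr (Or.inr (Or.inr (by rw [← h', add_add_self_zmod_two])))
    · rcases claim h hh.1 hh.2 hhj with h' | h'
      · exact Or.inl h'
      · exact Or.inr (Or.inl h')
  exact (Finset.card_le_card hsub).trans Finset.card_le_four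

theorem exists_split_of_card_eq_three {D : Finset (Fin n → ZMod 2)} (hD : D.card = 3) {i : Fin n}
    (hi : ¬ ∀ u ∈ D, ∀ v ∈ D, u i = v i) :
    ∃ x y z, D = {x, y, z} ∧ x ≠ y ∧ x i = y i ∧ z i ≠ x i := by
  obtain ⟨a, b, c, hab, hac, hbc, rfl⟩ := Finset.card_eq_three.1 hD
  by_cases h1 : a i = b i
  · refine ⟨a, b, c, rfl, hab, h1, fun h2 => hi ?_⟩
    simp [h1, h2]
  by_cases h2 : a i = c i
  · refine ⟨a, c, b, ?_, hac, h2, fun h => h1 h.symm⟩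
    rw [Finset.pair_comm]
  · refine ⟨b, c, a, ?_, hbc, ?_, h1⟩
    · ext v
      simp only [Finset.mem_insert, Finset.mem_singleton]
      tauto
    · have e1 := ZMod.two_eq_add_one_of_ne (Ne.symm h1)
      have e2 := ZMod.two_eq_add_one_of_ne (Ne.symm h2)
      rw [e1, e2]

/-- Three vertices are split by a coordinate `i` such that the two on the same side do not just
differ in a neighbouring coordinate `k`. -/
theorem exists_split_and_neighbor (hn : 3 ≤ n) {D : Finset (Fin n → ZMod 2)} (hD : D.card = 3) :
    ∃ (x y z : Fin n → ZMod 2) (i k : Fin n), D = {x, y, z} ∧ x ≠ y ∧ x i = y i ∧ z i ≠ x i ∧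
      (i.val + 1 = k.val ∨ k.val + 1 = i.val) ∧ x + y ≠ Pi.single k 1 := by
  by_cases hint : ∃ i : Fin n, (0 < i.val ∧ i.val + 1 < n) ∧ ¬ ∀ u ∈ D, ∀ v ∈ D, u i = v i
  · obtain ⟨i, ⟨h0, h1⟩, hi⟩ := hint
    obtain ⟨x, y, z, hDxyz, hxy, hxyi, hzi⟩ := exists_split_of_card_eq_three hD hi
    -- An interior coordinate has two neighbours, and `x + y` is the unit vector of at most one of
    -- them.
    by_cases h : x + y = Pi.single ⟨i.val - 1, by omega⟩ 1
    · refine ⟨x, y, z, i, ⟨i + 1, h1⟩, hDxyz, hxy, hxyi, hzi, Or.inl rfl, fun h' => ?_⟩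
      have := single_injective_zmod_two (h.symm.trans h')
      rw [Fin.ext_iff] at this
      simp only at this
      omega
    · exact ⟨x, y, z, i, _, hDxyz, hxy, hxyi, hzi, Or.inr (by simp only; omega), h⟩
  push Not at hint
  by_cases h0 : ∀ u ∈ D, ∀ v ∈ D, u ⟨0, by omega⟩ = v ⟨0, by omega⟩
  · exfalso
    -- If only the last coordinate could vary on `D`, then `D` would have at most two elements.
    have hinj : Set.InjOn (fun v : Fin n → ZMod 2 => v ⟨n - 1, by omega⟩) D := by
      intro u hu v hv huv
      funext k
      by_cases hk0 : k.val = 0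
      · rw [show k = ⟨0, by omega⟩ from Fin.ext hk0]
        exact h0 u hu v hv
      by_cases hk1 : k.val + 1 < n
      · exact hint k ⟨by omega, hk1⟩ u hu v hv
      · rw [show k = ⟨n - 1, by omega⟩ from Fin.ext (by simp only; omega)]
        exact huv
    have := Finset.card_le_card_of_injOn (t := (Finset.univ : Finset (ZMod 2))) _
      (fun _ _ => Finset.mem_coe.2 (Finset.mem_univ _)) hinj
    rw [hD, Finset.card_univ, ZMod.card] at this
    omega
  · obtain ⟨x, y, z, hDxyz, hxy, hxyi, hzi⟩ := exists_split_of_card_eq_three hD h0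
    refine ⟨x, y, z, _, ⟨1, by omega⟩, hDxyz, hxy, hxyi, hzi, Or.inl rfl, fun h => ?_⟩
    -- Coordinate 1 is interior because n ≥ 3, so it is constant on `D` and `x + y` vanishes there.
    have h1 := hint ⟨1, by omega⟩ ⟨by simp, by simp only; omega⟩ x (by simp [hDxyz]) y
      (by simp [hDxyz])
    have h2 := congrFun h ⟨1, by omega⟩
    simp [h1, CharTwo.add_self_eq_zero] at h2

theorem hasInternallyDisjointPaths_augGens {s : ℕ} (hn : n = 2 * s + 4)
    (D : Finset (Fin n → ZMod 2)) (hD : D.card = 3) :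
    HasInternallyDisjointPaths (cubeCayley (augGens n)) D ((s + 2) + ((s + 2) + s)) := by
  obtain ⟨x, y, z, i, k, rfl, hxy, hxyi, hzi, hik, hxyk⟩ := exists_split_and_neighbor (by omega) hD
  have hki : k ≠ i := fun h => by
    rw [h] at hik
    omega
  obtain ⟨m, rfl⟩ : ∃ m, n = m + 1 := ⟨n - 1, by omega⟩
  have h1 : ((Finset.univ.erase i).image fun j => (Pi.single j 1 : Fin (m + 1) → ZMod 2)) ⊆
      (augGens (m + 1)).filter fun h => h i = 0 := by
    intro h hh
    obtain ⟨j, hj, rfl⟩ := Finset.mem_image.1 hh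
    exact Finset.mem_filter.2 ⟨single_mem_augGens j, by
      simp [(Finset.ne_of_mem_erase hj).symm]⟩
  have h2 : ((Finset.univ.erase i).image fun j => (Pi.single j 1 : Fin (m + 1) → ZMod 2)).card ≤
      4 * s + 4 := by
    rw [Finset.card_image_of_injective _ single_injective_zmod_two,
      Finset.card_erase_of_mem (Finset.mem_univ _), Finset.card_univ, Fintype.card_fin]
    omega
  have h3 := card_augGens_filter m i
  -- `S` is trimmed to exactly 4s + 4 = 2n - 4 generators, since an end coordinate leaves one more
  -- available.
  obtain ⟨S, hS1, hS2, hScard⟩ := Finset.exists_subsuperset_card_eq h1 h2 (by omega)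
  have hbasis : ∀ j ≠ i, Pi.single j 1 ∈ S := fun j hj => hS1 (Finset.mem_image.2
    ⟨j, Finset.mem_erase.2 ⟨hj, Finset.mem_univ _⟩, rfl⟩)
  have hSS : S ⊆ augGens (m + 1) := hS2.trans (Finset.filter_subset _ _)
  refine hasInternallyDisjointPaths_cubeCayley (augGens (m + 1)) S zero_notMem_augGens hSS i
    (fun h hh => (Finset.mem_filter.1 (hS2 hh)).2) hbasis (by simpa using hn)
    (by simp only [Fintype.card_fin]; omega) (single_mem_augGens i) (Pi.single k 1) (hbasis k hki)
    ?_ hxy hxyi hzi hxyk ?_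
  · rcases hik with h | h
    · exact single_add_single_mem_augGens h
    · rw [add_comm (Pi.single i 1)]
      exact single_add_single_mem_augGens h
  · refine le_trans (Finset.card_le_card fun h hh => ?_) (card_augGens_filter_add_mem_le
      (g := x + y) fun h => hxy (add_eq_zero_iff_zmod_two.1 h))
    rw [Finset.mem_filter] at hh ⊢
    exact ⟨hSS hh.1, hSS hh.2⟩

end Generators

/-! ### Counting edge-ends for the upper bound -/

namespace SimpleGraph

variable {V : Type*} {G : SimpleGraph V}

theorem Walk.IsPath.not_three_edges_at {u v w a b c : V} {p : G.Walk u v} (hp : p.IsPath)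
    (hab : a ≠ b) (hac : a ≠ c) (hbc : b ≠ c) (ha : s(a, w) ∈ p.edges) (hb : s(b, w) ∈ p.edges) :
    s(c, w) ∉ p.edges := by
  classical
  intro hc
  have hw := p.snd_mem_support_of_mem_edges ha
  -- Splitting the path at `w`, an edge at `w` is the last one before the cut or the first one after
  -- it.
  have key : ∀ t, s(t, w) ∈ p.edges →
      t = (p.takeUntil w hw).penultimate ∨ t = (p.dropUntil w hw).snd := by
    intro t ht
    rw [← p.take_spec hw, Walk.edges_append, List.mem_append] at ht
    rw [Sym2.eq_swap] at ht
    exact ht.imp (hp.takeUntil hw).eq_penultimate_of_mem_edges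
      (hp.dropUntil hw).eq_snd_of_mem_edges
  have h1 := key a ha
  have h2 := key b hb
  have h3 := key c hc
  rcases h1 with h1 | h1 <;> rcases h2 with h2 | h2 <;> rcases h3 with h3 | h3 <;> simp_all

/-- In the order along the path, the middle vertex of `D` has two path edges and each of the outer
ones at least one. An edge inside `D` counts once for each end. -/
theorem Walk.IsPath.four_le_card_incidences [Fintype V] [DecidableEq V] {u v : V} {p : G.Walk u v}
    (hp : p.IsPath) {D : Finset V} (hD : D.card = 3) (h : ∀ v ∈ D, v ∈ p.support) :
    4 ≤ ((D ×ˢ (Finset.univ : Finset V)).filter fun q => s(q.1, q.2) ∈ p.edges).card := by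
  have hidx : ∀ v ∈ D, ∃ k, p.getVert k = v ∧ k ≤ p.length := fun v hv =>
    Walk.mem_support_iff_exists_getVert.1 (h v hv)
  have hsorted : ∃ k l m, k < l ∧ l < m ∧ m ≤ p.length ∧ p.getVert k ∈ D ∧ p.getVert l ∈ D ∧
      p.getVert m ∈ D := by
    obtain ⟨a, b, c, hab, hac, hbc, rfl⟩ := Finset.card_eq_three.1 hD
    obtain ⟨i, hi, hi'⟩ := hidx a (by simp)
    obtain ⟨j, hj, hj'⟩ := hidx b (by simp)
    obtain ⟨k, hk, hk'⟩ := hidx c (by simp)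
    have hij : i ≠ j := fun h => hab (by rw [← hi, ← hj, h])
    have hik : i ≠ k := fun h => hac (by rw [← hi, ← hk, h])
    have hjk : j ≠ k := fun h => hbc (by rw [← hj, ← hk, h])
    have hi : p.getVert i ∈ ({a, b, c} : Finset V) := by simp [hi]
    have hj : p.getVert j ∈ ({a, b, c} : Finset V) := by simp [hj]
    have hk : p.getVert k ∈ ({a, b, c} : Finset V) := by simp [hk]
    rcases lt_or_gt_of_ne hij with h1 | h1 <;> rcases lt_or_gt_of_ne hik with h2 | h2 <;>
      rcases lt_or_gt_of_ne hjk with h3 | h3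
    · exact ⟨i, j, k, h1, h3, hk', hi, hj, hk⟩
    · exact ⟨i, k, j, h2, h3, hj', hi, hk, hj⟩
    · omega
    · exact ⟨k, i, j, h2, h1, hj', hk, hi, hj⟩
    · exact ⟨j, i, k, h1, h2, hk', hj, hi, hk⟩
    · omega
    · exact ⟨j, k, i, h3, h2, hi', hj, hk, hi⟩
    · exact ⟨k, j, i, h3, h1, hi', hk, hj, hi⟩
  obtain ⟨k, l, m, hkl, hlm, hm, hk, hl, hm'⟩ := hsorted
  have hinj : ∀ i j, i ≤ p.length → j ≤ p.length → p.getVert i = p.getVert j → i = j :=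
    fun i j hi hj => hp.getVert_injOn hi hj
  have hedge : ∀ i < p.length, s(p.getVert i, p.getVert (i + 1)) ∈ p.edges := fun i hi =>
    p.mk_mem_edges_iff_exists.2 ⟨i, hi, rfl⟩
  obtain ⟨l, rfl⟩ : ∃ l', l = l' + 1 := ⟨l - 1, by omega⟩
  obtain ⟨m, rfl⟩ : ∃ m', m = m' + 1 := ⟨m - 1, by omega⟩
  have hsub : ({(p.getVert k, p.getVert (k + 1)), (p.getVert (l + 1), p.getVert l),
      (p.getVert (l + 1), p.getVert (l + 1 + 1)), (p.getVert (m + 1), p.getVert m)} :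
      Finset (V × V)) ⊆
      (D ×ˢ (Finset.univ : Finset V)).filter fun q => s(q.1, q.2) ∈ p.edges := by
    intro q hq
    simp only [Finset.mem_insert, Finset.mem_singleton] at hq
    simp only [Finset.mem_filter, Finset.mem_product, Finset.mem_univ, and_true]
    rcases hq with rfl | rfl | rfl | rfl
    · exact ⟨hk, hedge k (by omega)⟩
    · exact ⟨hl, Sym2.eq_swap ▸ hedge l (by omega)⟩
    · exact ⟨hl, hedge (l + 1) (by omega)⟩
    · exact ⟨hm', Sym2.eq_swap ▸ hedge m (by omega)⟩
  refine le_trans (le_of_eq ?_) (Finset.card_le_card hsub)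
  have hne : ∀ i j, i ≤ p.length → j ≤ p.length → i ≠ j → p.getVert i ≠ p.getVert j :=
    fun i j hi hj hij h => hij (hinj i j hi hj h)
  rw [Finset.card_insert_of_notMem, Finset.card_insert_of_notMem, Finset.card_insert_of_notMem,
    Finset.card_singleton]
  · simp [hne (l + 1) (m + 1) (by omega) (by omega) (by omega)]
  · simp [hne (l + 1) (m + 1) (by omega) (by omega) (by omega),
      hne l (l + 1 + 1) (by omega) (by omega) (by omega)]
  · simp [hne k (m + 1) (by omega) (by omega) (by omega),
      hne k (l + 1) (by omega) (by omega) (by omega)]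

end SimpleGraph

/-- If a set of three vertices has two common neighbours, then not all edges at these vertices can
be used by internally disjoint paths. -/
theorem HasInternallyDisjointPaths.four_mul_add_two_le {V : Type*} [Fintype V] [DecidableEq V]
    {G : SimpleGraph V} [DecidableRel G.Adj] {d m : ℕ} (hdeg : ∀ v, G.degree v ≤ d) {D : Finset V}
    (hD : D.card = 3) {w₁ w₂ : V} (hw : w₁ ≠ w₂) (hw₁ : w₁ ∉ D) (hw₂ : w₂ ∉ D)
    (h₁ : ∀ v ∈ D, G.Adj v w₁) (h₂ : ∀ v ∈ D, G.Adj v w₂)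
    (h : HasInternallyDisjointPaths G D m) : 4 * m + 2 ≤ 3 * d := by
  obtain ⟨a, b, P, hP, hPP⟩ := h
  let E : Fin m → Finset (V × V) := fun i =>
    (D ×ˢ (Finset.univ : Finset V)).filter fun q => s(q.1, q.2) ∈ (P i).edges
  have hE : ∀ i, 4 ≤ (E i).card := fun i => (hP i).1.four_le_card_incidences hD (hP i).2
  have hEE : ∀ i j, i ≠ j → Disjoint (E i) (E j) := fun i j hij => by
    rw [Finset.disjoint_left]
    intro q hq hq'
    exact (hPP i j hij).2 (Finset.mem_filter.1 hq).2 (Finset.mem_filter.1 hq').2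
  -- A vertex outside `D` lies on at most one of the paths, and that path cannot have three edges
  -- there.
  have hunused : ∀ w, w ∉ D → ∃ v ∈ D, ∀ i, (v, w) ∉ E i := by
    intro w hwD
    by_contra! hc
    have hsame : ∀ i j u v, (u, w) ∈ E i → (v, w) ∈ E j → i = j := by
      intro i j u v hi hj
      by_contra hij
      have h1 := Walk.snd_mem_support_of_mem_edges _ (Finset.mem_filter.1 hi).2
      have h2 := Walk.snd_mem_support_of_mem_edges _ (Finset.mem_filter.1 hj).2
      have : w ∈ (D : Set V) := (hPP i j hij).1 ▸ ⟨h1, h2⟩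
      exact hwD this
    obtain ⟨x, y, z, hxy, hxz, hyz, rfl⟩ := Finset.card_eq_three.1 hD
    obtain ⟨i, hi⟩ := hc x (by simp)
    obtain ⟨j, hj⟩ := hc y (by simp)
    obtain ⟨k, hk⟩ := hc z (by simp)
    obtain rfl := hsame i j x y hi hj
    obtain rfl := hsame i k x z hi hk
    exact (hP i).1.not_three_edges_at hxy hxz hyz (Finset.mem_filter.1 hi).2
      (Finset.mem_filter.1 hj).2 (Finset.mem_filter.1 hk).2
  obtain ⟨v₁, hv₁, hv₁'⟩ := hunused w₁ hw₁
  obtain ⟨v₂, hv₂, hv₂'⟩ := hunused w₂ hw₂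
  let A : Finset (V × V) := (D ×ˢ (Finset.univ : Finset V)).filter fun q => G.Adj q.1 q.2
  have hA : A.card ≤ 3 * d := by
    have : A.card = ∑ v ∈ D, G.degree v := by
      rw [Finset.card_filter, Finset.sum_product]
      refine Finset.sum_congr rfl fun v _ => ?_
      rw [← Finset.card_filter, ← G.card_neighborFinset_eq_degree]
      congr 1
      ext w
      simp
    rw [this, ← hD, ← smul_eq_mul]
    exact Finset.sum_le_card_nsmul _ _ _ fun v _ => hdeg v
  -- The 4m used incidences and the two unused ones are distinct members of `A`, which has at most
  -- 3d elements.
  have hsub : insert (v₁, w₁) (insert (v₂, w₂) (Finset.univ.biUnion E)) ⊆ A := by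
    intro q hq
    rw [Finset.mem_insert, Finset.mem_insert, Finset.mem_biUnion] at hq
    rw [Finset.mem_filter, Finset.mem_product]
    rcases hq with rfl | rfl | ⟨i, -, hi⟩
    · exact ⟨⟨hv₁, Finset.mem_univ _⟩, h₁ _ hv₁⟩
    · exact ⟨⟨hv₂, Finset.mem_univ _⟩, h₂ _ hv₂⟩
    · rw [Finset.mem_filter, Finset.mem_product] at hi
      exact ⟨hi.1, (P i).adj_of_mem_edges hi.2⟩
  have hcard := Finset.card_le_card hsub
  rw [Finset.card_insert_of_notMem, Finset.card_insert_of_notMem,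
    Finset.card_biUnion fun i _ j _ hij => hEE i j hij] at hcard
  · have hsum := Finset.card_nsmul_le_sum Finset.univ (fun i => (E i).card) 4 fun i _ => hE i
    rw [Finset.card_univ, Fintype.card_fin, smul_eq_mul] at hsum
    omega
  · simpa using hv₂'
  · simpa [hw] using hv₁'

/-! ### Passage from bit strings to the Cayley graph -/

/-- Internally disjoint paths are carried along injective graph homomorphisms. -/
theorem HasInternallyDisjointPaths.map {V W : Type*} [DecidableEq W] {G : SimpleGraph V}
    {H : SimpleGraph W} (f : G →g H) (hf : Function.Injective f) {D : Finset V} {m : ℕ}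
    (h : HasInternallyDisjointPaths G D m) : HasInternallyDisjointPaths H (D.image f) m := by
  obtain ⟨a, b, P, hP, hPP⟩ := h
  refine ⟨fun i => f (a i), fun i => f (b i), fun i => (P i).map f,
    fun i => ⟨Walk.IsPath.map hf (hP i).1, fun v hv => ?_⟩, fun i j hij => ⟨?_, ?_⟩⟩
  · obtain ⟨u, hu, rfl⟩ := Finset.mem_image.1 hv
    rw [Walk.support_map]
    exact List.mem_map_of_mem ((hP i).2 u hu)
  · rw [Finset.coe_image, ← (hPP i j hij).1]
    ext v
    simp only [Walk.support_map, List.mem_map, Set.mem_ofPred_eq, Set.mem_image]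
    constructor
    · rintro ⟨⟨u, hu, rfl⟩, u', hu', he⟩
      exact ⟨u, ⟨hu, hf he ▸ hu'⟩, rfl⟩
    · rintro ⟨u, ⟨hu, hu'⟩, rfl⟩
      exact ⟨⟨u, hu, rfl⟩, u, hu', rfl⟩
  · rw [Walk.edges_map, Walk.edges_map]
    intro e he he'
    obtain ⟨x, hx, rfl⟩ := List.mem_map.1 he
    obtain ⟨y, hy, hxy⟩ := List.mem_map.1 he'
    rw [Sym2.map.injective hf hxy] at hy
    exact (hPP i j hij).2 hx hy

section GrayCode

/-- A bit as an element of `ZMod 2`. -/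
def bitZMod (b : Bool) : ZMod 2 := if b then 1 else 0

theorem bitZMod_not (b : Bool) : bitZMod (!b) = bitZMod b + 1 := by
  cases b <;> decide

theorem bitZMod_add_bitZMod_of_ne {a b : Bool} (h : a ≠ b) : bitZMod a + bitZMod b = 1 := by
  cases a <;> cases b <;> first | rfl | exact absurd rfl h

theorem bitZMod_injective : Function.Injective bitZMod := by
  intro a b
  cases a <;> cases b <;> decide

/-- The leading unit vector, which is zero in dimension zero. -/
def leadingUnit (n : ℕ) : Fin n → ZMod 2 := fun j => if j.val = 0 then 1 else 0

theorem single_zero_one_eq_cons (n : ℕ) :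
    (Pi.single 0 1 : Fin (n + 1) → ZMod 2) = Fin.cons 1 0 := by
  ext j
  refine Fin.cases ?_ (fun j => ?_) j <;> simp

theorem single_succ_one_eq_cons {n : ℕ} (k : Fin n) :
    (Pi.single k.succ 1 : Fin (n + 1) → ZMod 2) = Fin.cons 0 (Pi.single k 1) := by
  ext j
  refine Fin.cases ?_ (fun j => ?_) j <;> simp [Pi.single_apply]

theorem leadingUnit_succ (n : ℕ) : leadingUnit (n + 1) = Fin.cons 1 0 := by
  ext j
  refine Fin.cases ?_ (fun j => ?_) j <;> simp [leadingUnit]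

theorem cons_add_cons_zmod_two {n : ℕ} (a b : ZMod 2) (v w : Fin n → ZMod 2) :
    (Fin.cons a v + Fin.cons b w : Fin (n + 1) → ZMod 2) = Fin.cons (a + b) (v + w) := by
  ext j
  refine Fin.cases ?_ (fun j => ?_) j <;> simp

theorem cons_zero_mem_augGens {n : ℕ} {v : Fin n → ZMod 2} :
    (Fin.cons 0 v : Fin (n + 1) → ZMod 2) ∈ augGens (n + 1) ↔ v ∈ augGens n := by
  rw [mem_augGens, mem_augGens]
  constructor
  · rintro (⟨j, hj⟩ | ⟨j, k, hjk, hj⟩)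
    · induction j using Fin.cases with
      | zero => simpa using congrFun hj 0
      | succ j =>
        rw [single_succ_one_eq_cons, Fin.cons_inj] at hj
        exact Or.inl ⟨j, hj.2⟩
    · induction k using Fin.cases with
      | zero => simp at hjk
      | succ k =>
        induction j using Fin.cases with
        | zero => simpa using congrFun hj 0
        | succ j =>
          rw [single_succ_one_eq_cons, single_succ_one_eq_cons, cons_add_cons_zmod_two,
            Fin.cons_inj] at hj
          exact Or.inr ⟨j, k, by simpa using hjk, hj.2⟩
  · rintro (⟨j, rfl⟩ | ⟨j, k, hjk, rfl⟩)
    · exact Or.inl ⟨j.succ, (single_succ_one_eq_cons j).symm⟩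
    · refine Or.inr ⟨j.succ, k.succ, by simpa using hjk, ?_⟩
      rw [single_succ_one_eq_cons, single_succ_one_eq_cons, cons_add_cons_zmod_two, add_zero]

/-- The two cases are the complementary edge (`v = 0`) and the hypercubic edge (`v = leadingUnit n`)
at the leading bit; in dimension one they coincide. -/
theorem cons_one_mem_augGens {n : ℕ} {v : Fin n → ZMod 2} :
    (Fin.cons 1 v : Fin (n + 1) → ZMod 2) ∈ augGens (n + 1) ↔ v = 0 ∨ v = leadingUnit n := by
  have hlead : ∀ k : Fin n, k.val = 0 → Pi.single k 1 = leadingUnit n := by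
    intro k hk
    ext j
    simp [Pi.single_apply, leadingUnit, Fin.ext_iff, hk]
  rw [mem_augGens]
  constructor
  · rintro (⟨j, hj⟩ | ⟨j, k, hjk, hj⟩)
    · induction j using Fin.cases with
      | zero =>
        rw [single_zero_one_eq_cons, Fin.cons_inj] at hj
        exact Or.inl hj.2
      | succ j => simpa using congrFun hj 0
    · induction k using Fin.cases with
      | zero => simp at hjk
      | succ k =>
        induction j using Fin.cases with
        | zero =>
          rw [single_zero_one_eq_cons, single_succ_one_eq_cons, cons_add_cons_zmod_two,
            Fin.cons_inj, zero_add] at hj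
          exact Or.inr (hj.2.trans (hlead k (by simpa using hjk.symm)))
        | succ j => simpa using congrFun hj 0
  · rintro (rfl | rfl)
    · exact Or.inl ⟨0, (single_zero_one_eq_cons n).symm⟩
    · cases n with
      | zero => exact Or.inl ⟨0, by rw [single_zero_one_eq_cons]; congr 1; ext j; exact j.elim0⟩
      | succ n =>
        refine Or.inr ⟨0, Fin.succ 0, by simp, ?_⟩
        rw [single_zero_one_eq_cons, single_succ_one_eq_cons, cons_add_cons_zmod_two, zero_add,
          add_zero, hlead 0 rfl]

/-- The coordinates on bit strings in which the edges of the augmented cube become translations: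
the leading bit is kept and every other bit is added to the preceding one. -/
def grayCode : (n : ℕ) → (Fin n → Bool) → Fin n → ZMod 2
  | 0, _ => 0
  | n + 1, x =>
    Fin.cons (bitZMod (x 0)) (grayCode n (Fin.tail x) + bitZMod (x 0) • leadingUnit n)

/-- Complementing all bits preserves the sums of consecutive bits, so only the leading coordinate
changes. -/
theorem grayCode_not {n : ℕ} (x : Fin n → Bool) :
    grayCode n (fun i => !x i) = grayCode n x + leadingUnit n := by
  induction n with
  | zero => exact Subsingleton.elim _ _
  | succ n ih =>
    have htail : Fin.tail (fun i => !x i) = fun i => !Fin.tail x i := rfl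
    rw [grayCode, grayCode, htail, ih, leadingUnit_succ, cons_add_cons_zmod_two, bitZMod_not,
      add_zero, add_smul, one_smul, add_assoc, add_comm (bitZMod (x 0) • leadingUnit n),
      add_add_self_zmod_two]

theorem grayCode_add_grayCode {n : ℕ} (x y : Fin (n + 1) → Bool) :
    grayCode (n + 1) x + grayCode (n + 1) y = Fin.cons (bitZMod (x 0) + bitZMod (y 0))
      (grayCode n (Fin.tail x) + grayCode n (Fin.tail y) +
        (bitZMod (x 0) + bitZMod (y 0)) • leadingUnit n) := by
  rw [grayCode, grayCode, cons_add_cons_zmod_two, add_smul, add_add_add_comm]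

theorem grayCode_injective (n : ℕ) : Function.Injective (grayCode n) := by
  induction n with
  | zero => exact fun _ _ _ => Subsingleton.elim _ _
  | succ n ih =>
    intro x y h
    rw [grayCode, grayCode, Fin.cons_inj] at h
    have h0 := bitZMod_injective h.1
    rw [h0] at h
    have h1 := ih (add_right_cancel h.2)
    rw [← Fin.cons_self_tail x, ← Fin.cons_self_tail y, h0, h1]

theorem grayCode_add_grayCode_mem_augGens {n : ℕ} {x y : Fin n → Bool} :
    grayCode n x + grayCode n y ∈ augGens n ↔ (augmentedCube n).Adj x y := by
  induction n with
  | zero =>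
    rw [mem_augGens]
    constructor
    · rintro (⟨j, -⟩ | ⟨j, -⟩) <;> exact j.elim0
    · exact fun h => absurd h id
  | succ n ih =>
    change _ ↔ (x 0 = y 0 ∧ _) ∨ (x 0 ≠ y 0 ∧ _)
    rw [grayCode_add_grayCode]
    by_cases h : x 0 = y 0
    · rw [h, CharTwo.add_self_eq_zero, zero_smul, add_zero, cons_zero_mem_augGens, ih]
      simp
    · rw [bitZMod_add_bitZMod_of_ne h, one_smul, cons_one_mem_augGens]
      simp only [h, false_and, false_or, ne_eq, not_false_eq_true, true_and]
      rw [or_comm]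
      refine or_congr ?_ ?_
      · rw [add_eq_right, add_eq_zero_iff_zmod_two, (grayCode_injective n).eq_iff, eq_comm]
      · rw [add_eq_zero_iff_zmod_two, ← (grayCode_injective n).eq_iff, grayCode_not]
        constructor
        · intro h
          rw [← h, add_add_self_zmod_two]
        · intro h
          rw [h, add_add_self_zmod_two]

/-- The augmented cube is a Cayley graph of an elementary abelian group. -/
noncomputable def augmentedCubeIso (n : ℕ) : augmentedCube n ≃g cubeCayley (augGens n) where
  toEquiv := Equiv.ofBijective (grayCode n)
    ((Fintype.bijective_iff_injective_and_card _).2 ⟨grayCode_injective n, by simp⟩)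
  map_rel_iff' := by
    intro x y
    rw [cubeCayley_adj_iff zero_notMem_augGens]
    exact grayCode_add_grayCode_mem_augGens

end GrayCode

/-! ### The extremal triple and the final assembly -/

theorem degree_cubeCayley_augGens (m : ℕ) [DecidableRel (cubeCayley (augGens (m + 1))).Adj]
    (v : Fin (m + 1) → ZMod 2) : (cubeCayley (augGens (m + 1))).degree v = 2 * m + 1 := by
  rw [← card_augGens, ← card_cubeNeighbors zero_notMem_augGens v, ← card_neighborFinset_eq_degree]
  congr 1
  ext w
  rw [mem_neighborFinset, mem_cubeNeighbors]

theorem exists_three_vertices_augGens {m n : ℕ} (hn : n = m + 3) :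
    ∃ D : Finset (Fin n → ZMod 2), D.card = 3 ∧ ∀ k,
      HasInternallyDisjointPaths (cubeCayley (augGens n)) D k → 4 * k + 2 ≤ 3 * (2 * m + 5) := by
  classical
  subst hn
  let e : Fin (m + 3) → Fin (m + 3) → ZMod 2 := fun j => Pi.single j 1
  have h01 : e 0 + e 1 ∈ augGens (m + 3) := single_add_single_mem_augGens (by simp)
  have hval : (2 : Fin (m + 3)).val = 2 := Nat.mod_eq_of_lt (by simp)
  have h12 : e 1 + e 2 ∈ augGens (m + 3) := single_add_single_mem_augGens (by rw [hval]; simp)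
  have hs : ∀ j, e j ∈ augGens (m + 3) := single_mem_augGens
  have hv : ∀ j k, e j k = if k = j then 1 else 0 := fun j k => Pi.single_apply j 1 k
  have h10 : (1 : Fin (m + 3)) ≠ 0 := by simp
  have h20 : (2 : Fin (m + 3)) ≠ 0 := by
    rw [Ne, Fin.ext_iff, hval]
    simp
  have h21 : (2 : Fin (m + 3)) ≠ 1 := by
    rw [Ne, Fin.ext_iff, hval]
    simp
  have hD : ({e 0, e 2, e 0 + e 1} : Finset (Fin (m + 3) → ZMod 2)).card = 3 := by
    rw [Finset.card_eq_three]
    refine ⟨_, _, _, fun h => ?_, fun h => ?_, fun h => ?_, rfl⟩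
    · simpa [hv, h20.symm] using congrFun h 0
    · simpa [hv, h10] using congrFun h 1
    · simpa [hv, h20.symm, h10.symm] using congrFun h 0
  refine ⟨_, hD, fun k hk => ?_⟩
  -- All three vertices are generators, hence neighbours of 0; their differences from e_0 + e_1 +
  -- e_2 are e_1 + e_2, e_0 + e_1 and e_2, again generators.
  refine hk.four_mul_add_two_le (d := 2 * m + 5) (w₁ := 0) (w₂ := e 0 + e 1 + e 2)
    (fun v => (degree_cubeCayley_augGens (m + 2) v).le) hD (fun h => ?_) ?_ ?_ ?_ ?_
  · simpa [hv, h20.symm, h10.symm] using congrFun h 0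
  · intro h
    simp only [Finset.mem_insert, Finset.mem_singleton] at h
    rcases h with h | h | h
    · simpa [hv] using congrFun h 0
    · simpa [hv] using congrFun h 2
    · simpa [hv, h10.symm] using congrFun h 0
  · intro h
    simp only [Finset.mem_insert, Finset.mem_singleton] at h
    rcases h with h | h | h
    · simpa [hv, h20, h21] using congrFun h 2
    · simpa [hv, h20.symm, h10.symm] using congrFun h 0
    · simpa [hv, h20, h21] using congrFun h 2
  · intro v hv
    rw [cubeCayley_adj_iff zero_notMem_augGens, add_zero]
    simp only [Finset.mem_insert, Finset.mem_singleton] at hv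
    rcases hv with rfl | rfl | rfl
    exacts [hs 0, hs 2, h01]
  · intro v hv
    rw [cubeCayley_adj_iff zero_notMem_augGens]
    simp only [Finset.mem_insert, Finset.mem_singleton] at hv
    rcases hv with rfl | rfl | rfl
    · rwa [add_assoc (e 0), add_add_self_zmod_two]
    · rwa [add_comm (e 2), add_self_add_zmod_two]
    · rw [add_add_self_zmod_two]
      exact hs 2

theorem theorem1 (n : ℕ) (hn : 4 ≤ n) (heven : Even n) :
    pathConnectivity (augmentedCube n) 3 = ((3 * n / 2 - 2 : ℕ) : ℕ∞) := by
  classical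
  obtain ⟨s, hs⟩ : ∃ s, n = 2 * s + 4 := by
    obtain ⟨r, hr⟩ := heven
    exact ⟨r - 2, by omega⟩
  have hval : 3 * n / 2 - 2 = (s + 2) + ((s + 2) + s) := by omega
  have hinj := (augmentedCubeIso n).injective
  have hinj' := (augmentedCubeIso n).symm.injective
  rw [hval]
  refine le_antisymm ?_ (le_iInf₂ fun D hD => ?_)
  -- For n = 2s + 4 the count reads 4k + 2 ≤ 12s + 21, hence k ≤ 3s + 4.
  · obtain ⟨D, hD, h⟩ := exists_three_vertices_augGens (m := 2 * s + 1) (n := n) (by omega)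
    refine (iInf₂_le (D.image (augmentedCubeIso n).symm)
      (by rw [Finset.card_image_of_injective _ hinj', hD])).trans (iSup₂_le fun k hk => ?_)
    have hk' : HasInternallyDisjointPaths (cubeCayley (augGens n))
        ((D.image (augmentedCubeIso n).symm).image (augmentedCubeIso n)) k :=
      hk.map (augmentedCubeIso n : _ →g cubeCayley (augGens n)) hinj
    rw [Finset.image_image, show _ ∘ _ = id from
      funext (augmentedCubeIso n).apply_symm_apply, Finset.image_id] at hk'
    have := h k hk'
    exact Nat.cast_le.2 (by omega)
  · have h : HasInternallyDisjointPaths (augmentedCube n)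
        ((D.image (augmentedCubeIso n)).image (augmentedCubeIso n).symm) _ :=
      (hasInternallyDisjointPaths_augGens hs (D.image (augmentedCubeIso n))
        (by rw [Finset.card_image_of_injective _ hinj, hD])).map
        ((augmentedCubeIso n).symm : _ →g augmentedCube n) hinj'
    rw [Finset.image_image, show _ ∘ _ = id from
      funext (augmentedCubeIso n).symm_apply_apply, Finset.image_id] at h
    exact le_iSup₂_of_le _ h le_rfl
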